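/- Let $\Bbbk$ be an algebraically closed field of characteristic zero. Let $H$ be a semisimple Hopf algebra over $\Bbbk$ (i.e. one whose underlying algebra is semisimple), with coproduct $h\mapsto h_{(1)}\otimes h_{(2)}$ and counit $\varepsilon$. Let $K$ be a semisimple left $H$-comodule algebra, i.e. a semisimple $\Bbbk$-algebra with a coassociative, counital left coaction $K\to H\otimes K$, $x\mapsto x_{(-1)}\otimes x_{(0)}$, which is a morphism of algebras, and let $A$ be a semisimple left $H$-module algebra, i.e. a semisimple $\Bbbk$-algebra with a left $H$-module structure such that $h.(ab)=(h_{(1)}.a)(h_{(2)}.b)$ and $h.1=\varepsilon(h)1$. The crossed product algebra $A\ltimes K$ is the vector space $A\otimes K$ with unit $1\otimes 1$ and multiplication $$(a\otimes x)\cdot(a'\otimes x') = a\,(x_{(-1)}.a')\otimes x_{(0)}x'.$$ A symmetric separability idempotent of a $\Bbbk$-algebra $B$ is an element $q=q^1\otimes q^2\in B\otimes B$ (summation understood) such that $xq^1\otimes q^2=q^1\otimes q^2x$ for all $x\in B$, $q^1q^2=1$ and $q^1\otimes q^2=q^2\otimes q^1$. Let $p^1\otimes p^2\in K\otimes K$ be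 the symmetric separability idempotent of $K$ and $\pi^1\otimes\pi^2\in A\otimes A$ the symmetric separability idempotent of $A$. Then the elements $$(1_A\otimes p^1)\otimes(1_A\otimes p^2)\qquad\text{and}\qquad(\pi^1\otimes 1_K)\otimes(\pi^2\otimes 1_K)$$ commute in the algebra $(A\ltimes K)\otimes(A\ltimes K)^{\mathrm{op}}$. -/

import Mathlib

open scoped TensorProduct

universe u v w x

/-- A left module algebra over the Hopf algebra `H`: an algebra `A` with a (unital, associative,
`k`-bilinear) left action of `H` such that `h.(a b) = (h₁.a) (h₂.b)` and `h.1 = ε(h) 1`. -/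
structure LeftModuleAlgebra (k : Type u) (H : Type v) (A : Type w) [Field k]
    [Ring H] [HopfAlgebra k H] [Ring A] [Algebra k A] where
  /-- the left action `h ↦ (a ↦ h.a)` -/
  act : H →ₐ[k] Module.End k A
  act_mul : ∀ (h : H) (a b : A), act h (a * b) =
    LinearMap.mul' k A
      (TensorProduct.map (act.toLinearMap.flip a) (act.toLinearMap.flip b)
        (Coalgebra.comul (R := k) h))
  act_one : ∀ h : H, act h 1 = algebraMap k A (Coalgebra.counit (R := k) h)

/-- A left comodule algebra over the Hopf algebra `H`: an algebra `K` with a coassociative and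
counital left coaction `K → H ⊗ K`, `x ↦ x₍₋₁₎ ⊗ x₍₀₎`, that is a morphism of algebras. -/
structure LeftComoduleAlgebra (k : Type u) (H : Type v) (K : Type w) [Field k]
    [Ring H] [HopfAlgebra k H] [Ring K] [Algebra k K] where
  /-- the left coaction -/
  coact : K →ₐ[k] H ⊗[k] K
  coassoc : ∀ x : K,
    TensorProduct.assoc k H H K
        (LinearMap.rTensor K (Coalgebra.comul (R := k) (A := H)) (coact x)) =
      LinearMap.lTensor H coact.toLinearMap (coact x)
  counit_coact : ∀ x : K,
    LinearMap.rTensor K (Coalgebra.counit (R := k) (A := H)) (coact x) = (1 : k) ⊗ₜ[k] x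

/-- `p = p¹ ⊗ p² ∈ A ⊗ A` is a symmetric separability idempotent for the algebra `A`. -/
structure IsSymmSepIdempotent (k : Type u) {A : Type w} [Field k] [Ring A] [Algebra k A]
    (p : A ⊗[k] A) : Prop where
  /-- `x p¹ ⊗ p² = p¹ ⊗ p² x` for all `x` -/
  invariance : ∀ x : A,
    LinearMap.rTensor A (LinearMap.mulLeft k x) p = LinearMap.lTensor A (LinearMap.mulRight k x) p
  /-- `p¹ p² = 1` -/
  normalization : LinearMap.mul' k A p = 1
  /-- `p¹ ⊗ p² = p² ⊗ p¹` -/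
  symmetry : TensorProduct.comm k A A p = p

/-- The underlying vector space `A ⊗ K` of the crossed product algebra of a left module algebra
`A` and a left comodule algebra `K` over the same Hopf algebra `H`. -/
def CrossedProduct {k : Type u} {H : Type v} {A : Type w} {K : Type x} [Field k]
    [Ring H] [HopfAlgebra k H] [Ring A] [Algebra k A] [Ring K] [Algebra k K]
    (_α : LeftModuleAlgebra k H A) (_δ : LeftComoduleAlgebra k H K) : Type (max w x) :=
  A ⊗[k] K

namespace CrossedProduct

variable {k : Type u} {H : Type v} {A : Type w} {K : Type x} [Field k]
  [Ring H] [HopfAlgebra k H] [Ring A] [Algebra k A] [Ring K] [Algebra k K]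
  (α : LeftModuleAlgebra k H A) (δ : LeftComoduleAlgebra k H K)

noncomputable instance : AddCommGroup (CrossedProduct α δ) :=
  inferInstanceAs (AddCommGroup (A ⊗[k] K))

noncomputable instance : Module k (CrossedProduct α δ) :=
  inferInstanceAs (Module k (A ⊗[k] K))

/-- The element `a ⊗ x` of the crossed product. -/
def tmul (a : A) (x : K) : CrossedProduct α δ := a ⊗ₜ[k] x

/-- The bilinear map `A × (H ⊗ K) → A ⊗ K`, `(a, h ⊗ y) ↦ h.a ⊗ y`. -/
noncomputable def actL : A →ₗ[k] H ⊗[k] K →ₗ[k] A ⊗[k] K :=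
  LinearMap.rTensorHom K ∘ₗ α.act.toLinearMap.flip

/-- The bilinear map `(A ⊗ K) × (A ⊗ K) → A ⊗ K` with
`(a ⊗ x, b ⊗ y) ↦ a (x₍₋₁₎.b) ⊗ x₍₀₎ y`. -/
noncomputable def mulAux : A ⊗[k] K →ₗ[k] A ⊗[k] K →ₗ[k] A ⊗[k] K :=
  TensorProduct.lift <| LinearMap.mk₂ k
    (fun (a : A) (x : K) => TensorProduct.lift <| LinearMap.mk₂ k
      (fun (b : A) (y : K) =>
        TensorProduct.map (LinearMap.mulLeft k a) (LinearMap.mulRight k y)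
          (actL (K := K) α b (δ.coact x)))
      (by intro b b' y; simp)
      (by intro c b y; simp)
      (by intro b y y'
          rw [show LinearMap.mulRight k (y + y') =
            LinearMap.mulRight k y + LinearMap.mulRight k y' by ext; simp [mul_add],
            TensorProduct.map_add_right, LinearMap.add_apply])
      (by intro c b y
          rw [show LinearMap.mulRight k (c • y) = c • LinearMap.mulRight k y by ext; simp,
            TensorProduct.map_smul_right, LinearMap.smul_apply]))
    (by intro a a' x
        ext b y
        simp only [TensorProduct.AlgebraTensorModule.curry_apply, TensorProduct.curry_apply,
          LinearMap.coe_restrictScalars, TensorProduct.lift.tmul, LinearMap.mk₂_apply,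
          LinearMap.add_apply]
        rw [show LinearMap.mulLeft k (a + a') =
            LinearMap.mulLeft k a + LinearMap.mulLeft k a' by ext; simp [add_mul],
            TensorProduct.map_add_left, LinearMap.add_apply])
    (by intro c a x
        ext b y
        simp only [TensorProduct.AlgebraTensorModule.curry_apply, TensorProduct.curry_apply,
          LinearMap.coe_restrictScalars, TensorProduct.lift.tmul, LinearMap.mk₂_apply,
          LinearMap.smul_apply]
        rw [show LinearMap.mulLeft k (c • a) = c • LinearMap.mulLeft k a by ext; simp,
            TensorProduct.map_smul_left, LinearMap.smul_apply])
    (by intro a x x'; ext b y; simp)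
    (by intro c a x; ext b y; simp)

theorem mulAux_tmul (a b : A) (x y : K) :
    mulAux α δ (a ⊗ₜ[k] x) (b ⊗ₜ[k] y) =
      TensorProduct.map (LinearMap.mulLeft k a) (LinearMap.mulRight k y)
        (actL (K := K) α b (δ.coact x)) := by
  simp [mulAux]

theorem mulAux_one_left (z : A ⊗[k] K) : mulAux α δ (1 ⊗ₜ[k] 1) z = z := by
  induction z with
  | zero => simp
  | add z z' h h' => rw [map_add, h, h']
  | tmul b y =>
    rw [mulAux_tmul, map_one, Algebra.TensorProduct.one_def]
    simp [actL]

theorem mulAux_one_right (z : A ⊗[k] K) : mulAux α δ z (1 ⊗ₜ[k] 1) = z := by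
  induction z with
  | zero => simp
  | add z z' h h' => rw [map_add, LinearMap.add_apply, h, h']
  | tmul a x =>
    rw [mulAux_tmul]
    have key : ∀ t : H ⊗[k] K, TensorProduct.map (LinearMap.mulLeft k a) (LinearMap.mulRight k 1)
        (actL (K := K) α 1 t) = TensorProduct.map (LinearMap.toSpanSingleton k A a) LinearMap.id
          (LinearMap.rTensor K (Coalgebra.counit (R := k) (A := H)) t) := by
      intro t
      induction t with
      | zero => simp
      | add t t' h h' => simp only [map_add, h, h']
      | tmul h y => simp [actL, α.act_one, Algebra.algebraMap_eq_smul_one]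
    rw [key, δ.counit_coact]
    simp

theorem mulAux_assoc (z z' z'' : A ⊗[k] K) :
    mulAux α δ (mulAux α δ z z') z'' = mulAux α δ z (mulAux α δ z' z'') := by
  induction z with
  | zero => simp
  | add z₁ z₂ h h' => simp only [map_add, LinearMap.add_apply, h, h']
  | tmul a x =>
  induction z' with
  | zero => simp
  | add z₁ z₂ h h' => simp only [map_add, LinearMap.add_apply, h, h']
  | tmul b y =>
  induction z'' with
  | zero => simp
  | add z₁ z₂ h h' => simp only [map_add, h, h']
  | tmul c w =>
    -- the common value is `F (δ y)` of the twofold coaction on `x`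
    let G (s : H ⊗[k] K) : H ⊗[k] K →ₗ[k] A ⊗[k] K :=
      (LinearMap.lTensor A (LinearMap.mulRight k w) ∘ₗ actL (K := K) α c) ∘ₗ
        LinearMap.mulRight k s
    let F (s : H ⊗[k] K) : H ⊗[k] (H ⊗[k] K) →ₗ[k] A ⊗[k] K :=
      LinearMap.rTensor K (LinearMap.mul' k A) ∘ₗ
        (TensorProduct.assoc k A A K).symm.toLinearMap ∘ₗ
          TensorProduct.map (LinearMap.mulLeft k a ∘ₗ α.act.toLinearMap.flip b) (G s)
    have left : ∀ t : H ⊗[k] K,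
        mulAux α δ (TensorProduct.map (LinearMap.mulLeft k a) (LinearMap.mulRight k y)
          (actL (K := K) α b t)) (c ⊗ₜ[k] w) =
            F (δ.coact y) (LinearMap.lTensor H δ.coact.toLinearMap t) := by
      intro t
      induction t with
      | zero => simp
      | add t t' h h' => simp only [map_add, LinearMap.add_apply, h, h']
      | tmul h x' =>
        simp only [actL, LinearMap.comp_apply, LinearMap.coe_rTensorHom, LinearMap.rTensor_tmul,
          TensorProduct.map_tmul, mulAux_tmul, LinearMap.mulRight_apply, map_mul,
          LinearMap.lTensor_tmul, F, G, LinearMap.flip_apply, AlgHom.toLinearMap_apply,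
          LinearMap.mulLeft_apply, LinearEquiv.coe_coe]
        generalize δ.coact x' * δ.coact y = s
        induction s with
        | zero => simp
        | add s s' h h' => simp only [map_add, TensorProduct.tmul_add, h, h']
        | tmul g v => simp [mul_assoc]
    have right : ∀ s : H ⊗[k] K,
        mulAux α δ (a ⊗ₜ[k] x) (TensorProduct.map (LinearMap.mulLeft k b) (LinearMap.mulRight k w)
          (actL (K := K) α c s)) =
            F s (TensorProduct.assoc k H H K
              (LinearMap.rTensor K (Coalgebra.comul (R := k) (A := H)) (δ.coact x))) := by
      intro s
      induction s with
      | zero =>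
        have h0 : G 0 = 0 := by ext; simp [G]
        simp [F, h0]
      | add s s' h h' =>
        have h0 : G (s + s') = G s + G s' := by ext; simp [G, mul_add]
        have h1 : F (s + s') = F s + F s' := by
          simp only [F, h0, TensorProduct.map_add_right, LinearMap.comp_add]
        rw [map_add, map_add, map_add, h, h', h1, LinearMap.add_apply]
      | tmul g v =>
        simp only [actL, LinearMap.comp_apply, LinearMap.coe_rTensorHom, LinearMap.rTensor_tmul,
          TensorProduct.map_tmul, mulAux_tmul, LinearMap.mulRight_apply,
          LinearMap.flip_apply, AlgHom.toLinearMap_apply, LinearMap.mulLeft_apply]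
        generalize δ.coact x = t
        induction t with
        | zero => simp
        | add t t' h h' => simp only [map_add, h, h']
        | tmul h x' =>
          simp only [LinearMap.rTensor_tmul, TensorProduct.map_tmul, LinearMap.mulRight_apply,
            LinearMap.flip_apply, AlgHom.toLinearMap_apply, LinearMap.mulLeft_apply, α.act_mul]
          generalize (Coalgebra.comul (R := k) h) = d
          induction d with
          | zero => simp
          | add d d' h h' =>
            simp only [map_add, TensorProduct.add_tmul, mul_add, h, h']
          | tmul d₁ d₂ => simp [F, G, actL, mul_assoc]
    rw [mulAux_tmul, left, ← δ.coassoc, mulAux_tmul, right]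

noncomputable instance : Ring (CrossedProduct α δ) :=
  { (inferInstance : AddCommGroup (CrossedProduct α δ)) with
    mul := fun z z' => mulAux α δ z z'
    one := tmul α δ 1 1
    one_mul := mulAux_one_left α δ
    mul_one := mulAux_one_right α δ
    mul_assoc := mulAux_assoc α δ
    left_distrib := fun z z' z'' => map_add (mulAux α δ z) z' z''
    right_distrib := fun z z' z'' => LinearMap.map_add₂ (mulAux α δ) z z' z''
    zero_mul := fun z => LinearMap.map_zero₂ (mulAux α δ) z
    mul_zero := fun z => map_zero (mulAux α δ z) }

noncomputable instance : Algebra k (CrossedProduct α δ) :=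
  Algebra.ofModule
    (fun c z z' => LinearMap.map_smul₂ (mulAux α δ) c z z')
    (fun c z z' => map_smul (mulAux α δ z) c z')

/-- The multiplication `(a ⊗ x) (b ⊗ y) = a (x₍₋₁₎.b) ⊗ x₍₀₎ y`, for any way of writing the
coaction on `x` as a sum of pure tensors. -/
theorem tmul_mul_tmul {ι : Type*} (s : Finset ι) (f : ι → H) (g : ι → K) (a b : A) (x y : K)
    (hx : δ.coact x = ∑ i ∈ s, f i ⊗ₜ[k] g i) :
    tmul α δ a x * tmul α δ b y = ∑ i ∈ s, tmul α δ (a * α.act (f i) b) (g i * y) := by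
  change mulAux α δ (a ⊗ₜ[k] x) (b ⊗ₜ[k] y) = _
  rw [mulAux_tmul, hx, map_sum, map_sum]
  exact Finset.sum_congr rfl fun i _ => by simp [actL, tmul]

/-- The inclusion `A → A ⊗ K`, `a ↦ a ⊗ 1`. -/
noncomputable def inl : A →ₗ[k] CrossedProduct α δ :=
  (TensorProduct.mk k A K).flip 1

/-- The inclusion `K → A ⊗ K`, `x ↦ 1 ⊗ x`. -/
noncomputable def inr : K →ₗ[k] CrossedProduct α δ :=
  TensorProduct.mk k A K 1

end CrossedProduct

/-- For a linear map `f : V → B` into an algebra, the linear map `V ⊗ V → B ⊗ Bᵒᵖ`,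
`v ⊗ w ↦ f v ⊗ f w`. -/
noncomputable def toEnveloping {k : Type u} {V : Type v} {B : Type w} [Field k]
    [AddCommGroup V] [Module k V] [Ring B] [Algebra k B] (f : V →ₗ[k] B) :
    V ⊗[k] V →ₗ[k] B ⊗[k] Bᵐᵒᵖ :=
  TensorProduct.map f ((MulOpposite.opLinearEquiv k).toLinearMap ∘ₗ f)

/-! Write Tr for the trace of the regular representation, on `A` and on `K`. A symmetric
separability idempotent is dual to it: Tr(x p¹) p² = x (`coslice_traceForm`). So Tr is
nondegenerate, and two elements of B ⊗ Bᵒᵖ, with B the crossed product, agree once the forms b ⊗ y ↦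
Tr(ab) Tr(xy) applied to their first leg agree (`eq_of_coslice_traceFunctional`). For π·p the result
is (1 ⊗ x)(a ⊗ 1), since the second leg multiplies in the opposite order. For p·π, the action of
p¹₍₋₁₎ on π¹ passes across Tr on `A` as S(p¹₍₋₁₎) acting on a (`traceForm_act_mul`), and the
coaction passes across Tr on `K` by y₍₋₁₎ Tr(x y₍₀₎) = S(x₍₋₁₎) Tr(x₍₀₎ y) (`slice_mulLeft_coact`).
The two antipodes cancel because S² = id, leaving x₍₋₁₎.a ⊗ x₍₀₎, which is again (1 ⊗ x)(a ⊗ 1).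

Most of the work is S² = id, the Larson–Radford theorem. Semisimplicity gives a normalized two-sided
integral Λ, which makes H separable, hence finite-dimensional. The form T(x) = Tr(y ↦ x S²(y)) is
coinvariant with T(Λ) = 1, so it is nondegenerate and spans the coinvariant forms. Its failure to be
coinvariant on the other side is a grouplike element g, and comparing T with T ∘ S shows that S⁴ is
conjugation by g⁻¹; hence S² has finite order. On the Wedderburn blocks S² is conjugation by some u,
and Tr(S²) = ∑ tr(uᵢ) tr(uᵢ⁻¹) is a sum of squared absolute values; it is nonzero, as otherwise T
would vanish on the centre, which contains Λ. So T(1) = Tr(S²) ≠ 0, which forces g = 1 and S⁴ = id.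
An integrality argument with the regular character then excludes the eigenvalue -1 of S². -/

/-! ### Coefficient matrices of a coaction and coinvariant forms. -/

namespace LeftComoduleAlgebra

variable {k : Type*} {H : Type*} {K : Type*} [Field k] [Ring H] [HopfAlgebra k H]
  [Ring K] [Algebra k K]

/-- The linear map `H ⊗ V → H`, `h ⊗ v ↦ φ v • h`. -/
noncomputable def slice (k H : Type*) {V : Type*} [Field k] [Ring H] [Algebra k H]
    [AddCommGroup V] [Module k V] (φ : V →ₗ[k] k) : H ⊗[k] V →ₗ[k] H :=
  (TensorProduct.rid k H).toLinearMap ∘ₗ LinearMap.lTensor H φ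

@[simp]
theorem slice_tmul {V : Type*} [AddCommGroup V] [Module k V] (φ : V →ₗ[k] k) (h : H) (v : V) :
    slice k H φ (h ⊗ₜ[k] v) = φ v • h := by
  simp [slice]

theorem sum_slice_coord_tmul {V ι : Type*} [AddCommGroup V] [Module k V] [Fintype ι]
    (b : Module.Basis ι k V) (t : H ⊗[k] V) : ∑ j, slice k H (b.coord j) t ⊗ₜ[k] b j = t := by
  induction t with
  | zero => simp
  | add t t' h h' => simp only [map_add, TensorProduct.add_tmul, Finset.sum_add_distrib, h, h']
  | tmul h v =>
    conv_rhs => rw [← b.sum_repr v, TensorProduct.tmul_sum]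
    simp [TensorProduct.smul_tmul']

variable (δ : LeftComoduleAlgebra k H K) {ι : Type*} [Fintype ι] (b : Module.Basis ι k K)

/-- The coefficients of the coaction with respect to a basis. -/
noncomputable def coeff (i j : ι) : H := slice k H (b.coord j) (δ.coact (b i))

theorem coact_basis (i : ι) : δ.coact (b i) = ∑ j, δ.coeff b i j ⊗ₜ[k] b j :=
  (sum_slice_coord_tmul b _).symm

theorem slice_coact_basis (φ : K →ₗ[k] k) (i : ι) :
    slice k H φ (δ.coact (b i)) = ∑ j, φ (b j) • δ.coeff b i j := by
  simp [coact_basis]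

/-- With the next lemmas, this turns Sweedler computations into matrix algebra: the coefficients
form a matrix c with Δ(c) = c ⊗ c and ε(c) = 1, whose inverse is S(c). -/
theorem comul_coeff (i j : ι) : Coalgebra.comul (R := k) (δ.coeff b i j) =
    ∑ l, δ.coeff b i l ⊗ₜ[k] δ.coeff b l j := by
  classical
  have h := congrArg (LinearMap.lTensor H (slice k H (b.coord j))) (δ.coassoc (b i))
  have key : ∀ (t : H ⊗[k] H) (v : K), LinearMap.lTensor H (slice k H (b.coord j))
      (TensorProduct.assoc k H H K (t ⊗ₜ[k] v)) = b.coord j v • t := by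
    intro t v
    induction t with
    | zero => simp
    | add t t' h h' => simp only [TensorProduct.add_tmul, map_add, h, h', smul_add]
    | tmul x y => simp
  simp only [coact_basis, map_sum, LinearMap.rTensor_tmul, key, LinearMap.lTensor_tmul,
    AlgHom.toLinearMap_apply, slice_tmul, Module.Basis.coord_apply, Module.Basis.repr_self,
    Finsupp.single_apply, ite_smul, one_smul, zero_smul, Finset.sum_ite_eq', Finset.mem_univ,
    if_true] at h
  exact h

theorem counit_coeff [DecidableEq ι] (i j : ι) :
    Coalgebra.counit (R := k) (δ.coeff b i j) = if i = j then 1 else 0 := by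
  have h := congrArg (LinearMap.mul' k k ∘ₗ LinearMap.lTensor k (b.coord j))
    (δ.counit_coact (b i))
  simpa [coact_basis, Finsupp.single_apply] using h

theorem sum_antipode_coeff_mul_coeff [DecidableEq ι] (i j : ι) :
    ∑ l, HopfAlgebra.antipode k (δ.coeff b i l) * δ.coeff b l j = if i = j then 1 else 0 := by
  have h := HopfAlgebra.mul_antipode_rTensor_comul_apply (R := k) (δ.coeff b i j)
  rw [comul_coeff, counit_coeff] at h
  simpa [apply_ite] using h

theorem sum_coeff_mul_antipode_coeff [DecidableEq ι] (i j : ι) :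
    ∑ l, δ.coeff b i l * HopfAlgebra.antipode k (δ.coeff b l j) = if i = j then 1 else 0 := by
  have h := HopfAlgebra.mul_antipode_lTensor_comul_apply (R := k) (δ.coeff b i j)
  rw [comul_coeff, counit_coeff] at h
  simpa [apply_ite] using h

theorem sum_antipode_antipode_coeff_mul_antipode_coeff [DecidableEq ι] (i j : ι) :
    ∑ l, HopfAlgebra.antipode k (HopfAlgebra.antipode k (δ.coeff b l j)) *
      HopfAlgebra.antipode k (δ.coeff b i l) = if i = j then 1 else 0 := by
  have h := congrArg (HopfAlgebra.antipode k) (δ.sum_coeff_mul_antipode_coeff b i j)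
  simpa [HopfAlgebra.antipode_mul_antidistrib, apply_ite] using h

/-- A linear form `T` on a left comodule algebra with `x₍₋₁₎ T(x₍₀₎) = T(x) 1`. -/
def IsCoinvariant (T : K →ₗ[k] k) : Prop := ∀ x, slice k H T (δ.coact x) = T x • (1 : H)

variable {δ} in
theorem isCoinvariant_of_basis {T : K →ₗ[k] k}
    (h : ∀ i, ∑ j, T (b j) • δ.coeff b i j = T (b i) • (1 : H)) : δ.IsCoinvariant T := by
  have : slice k H T ∘ₗ δ.coact.toLinearMap = T.smulRight 1 :=
    b.ext fun i => by simp [slice_coact_basis, h]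
  exact fun x => by simpa using LinearMap.congr_fun this x

/-- The linear form `x ↦ Tr (y ↦ x σ(y))`. -/
noncomputable def traceForm (K : Type*) [Ring K] [Algebra k K] (σ : K →ₗ[k] K) : K →ₗ[k] k :=
  LinearMap.trace k K ∘ₗ LinearMap.lcomp k K σ ∘ₗ LinearMap.mul k K

theorem traceForm_apply (σ : K →ₗ[k] K) (x : K) :
    traceForm K σ x = LinearMap.trace k K (LinearMap.mulLeft k x ∘ₗ σ) := rfl

theorem traceForm_eq_sum (σ : K →ₗ[k] K) (x : K) :
    traceForm K σ x = ∑ i, b.repr (x * σ (b i)) i := by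
  classical
  rw [traceForm_apply, LinearMap.trace_eq_matrix_trace k b]
  simp [Matrix.trace, LinearMap.toMatrix_apply]

/-- The twist by S² is what lets the coefficients of σ(y) cancel against an antipode on the outer
side. It is used with σ = S² on H itself, and with σ = id on `K` once S² = id is known. -/
theorem isCoinvariant_traceForm [FiniteDimensional k K] (σ : K →ₗ[k] K)
    (hσ : ∀ x, δ.coact (σ x) = TensorProduct.map
      (HopfAlgebra.antipode k ∘ₗ HopfAlgebra.antipode k) σ (δ.coact x)) :
    δ.IsCoinvariant (traceForm K σ) := by
  classical
  let b := Module.finBasis k K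
  apply isCoinvariant_of_basis b
  intro m
  let F (n i l) : k := b.repr (b n * σ (b i)) l
  let S : H →ₗ[k] H := HopfAlgebra.antipode k
  have h1 (i l) : ∑ p, F m i p • δ.coeff b p l =
      ∑ n, ∑ j, F n j l • (δ.coeff b m n * S (S (δ.coeff b i j))) := by
    have e1 : slice k H (b.coord l) (δ.coact (b m * σ (b i))) =
        ∑ p, F m i p • δ.coeff b p l := by
      conv_lhs => rw [← b.sum_repr (b m * σ (b i))]
      simp only [map_sum, map_smul, coeff, F]
    rw [← e1, map_mul, hσ, coact_basis, coact_basis]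
    simp [Finset.sum_mul, Finset.mul_sum, F, S]
    rw [Finset.sum_comm]
  -- Multiplying `h1` on the right by S(c_qi) and summing over i collapses S²(c_ij) S(c_qi) to the
  -- Kronecker delta of q and j.
  have h2 (l q) : ∑ i, ∑ p, F m i p • (δ.coeff b p l * S (δ.coeff b q i)) =
      ∑ n, F n q l • δ.coeff b m n := by
    have this (i) : ∑ p, F m i p • (δ.coeff b p l * S (δ.coeff b q i)) =
        ∑ n, ∑ j, F n j l • (δ.coeff b m n * (S (S (δ.coeff b i j)) * S (δ.coeff b q i))) := by
      have := congrArg (· * S (δ.coeff b q i)) (h1 i l)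
      simpa [Finset.sum_mul, mul_assoc] using this
    simp only [this]
    rw [Finset.sum_comm]
    refine Finset.sum_congr rfl fun n _ => ?_
    rw [Finset.sum_comm]
    simp only [← Finset.smul_sum, ← Finset.mul_sum, S,
      sum_antipode_antipode_coeff_mul_antipode_coeff]
    simp
  -- Taking the trace q = l makes the right side ∑ T(bₙ) c_mn, while on the left ∑ c_pl S(c_li) is a
  -- Kronecker delta and leaves T(b_m).
  have h3 := congrArg (fun f => ∑ l, f l l) (funext fun l => funext (h2 l))
  simp only at h3
  simp only [traceForm_eq_sum b, Finset.sum_smul]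
  rw [Finset.sum_comm]
  refine Eq.trans h3.symm ?_
  rw [Finset.sum_comm]
  refine Finset.sum_congr rfl fun i _ => ?_
  rw [Finset.sum_comm]
  simp only [← Finset.smul_sum, S, sum_coeff_mul_antipode_coeff]
  simp [F]

variable {δ} in
-- Both sides equal S(x₍₋₂₎) x₍₋₁₎ y₍₋₁₎ T(x₍₀₎ y₍₀₎): collapse S(x₍₋₂₎) x₍₋₁₎ for the left, apply
-- coinvariance to x₍₀₎ y₍₀₎ for the right.
theorem IsCoinvariant.slice_mulLeft_coact [FiniteDimensional k K] {T : K →ₗ[k] k}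
    (hT : δ.IsCoinvariant T) (x y : K) :
    slice k H (T ∘ₗ LinearMap.mulLeft k x) (δ.coact y) =
      HopfAlgebra.antipode k (slice k H (T ∘ₗ LinearMap.mulRight k y) (δ.coact x)) := by
  classical
  let b := Module.finBasis k K
  have key (m q) : ∑ l, T (b m * b l) • δ.coeff b q l =
      ∑ i, T (b i * b q) • HopfAlgebra.antipode k (δ.coeff b m i) := by
    have h (i) : ∑ n, ∑ l, T (b n * b l) • (δ.coeff b i n * δ.coeff b q l) =
        T (b i * b q) • (1 : H) := by
      rw [← hT, map_mul, coact_basis, coact_basis]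
      simp [Finset.sum_mul, Finset.mul_sum]
      rw [Finset.sum_comm]
    have h' (i) : ∑ n, ∑ l, T (b n * b l) •
        (HopfAlgebra.antipode k (δ.coeff b m i) * δ.coeff b i n * δ.coeff b q l) =
        T (b i * b q) • HopfAlgebra.antipode k (δ.coeff b m i) := by
      have := congrArg (HopfAlgebra.antipode k (δ.coeff b m i) * ·) (h i)
      simpa [Finset.mul_sum, mul_assoc] using this
    simp only [← h']
    rw [Finset.sum_comm]
    have this (n) : ∑ i, ∑ l, T (b n * b l) •
        (HopfAlgebra.antipode k (δ.coeff b m i) * δ.coeff b i n * δ.coeff b q l) =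
        ∑ l, T (b n * b l) • ((if m = n then 1 else 0) * δ.coeff b q l) := by
      rw [Finset.sum_comm]
      simp only [← Finset.smul_sum, ← Finset.sum_mul, sum_antipode_coeff_mul_coeff]
    simp only [this]
    rw [Finset.sum_comm]
    simp
  rw [← b.sum_repr x, ← b.sum_repr y]
  have e1 (i j) : slice k H (T ∘ₗ LinearMap.mulLeft k (b i)) (δ.coact (b j)) =
      HopfAlgebra.antipode k (slice k H (T ∘ₗ LinearMap.mulRight k (b j)) (δ.coact (b i))) := by
    rw [slice_coact_basis, slice_coact_basis]
    simpa using key i j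
  have hl (c : K) : slice k H (T ∘ₗ LinearMap.mulLeft k c) =
      ∑ i, b.repr c i • slice k H (T ∘ₗ LinearMap.mulLeft k (b i)) := by
    refine TensorProduct.ext' fun h v => ?_
    have := congrArg (fun z => T (z * v) • h) (b.sum_repr c)
    simpa [-Module.Basis.sum_repr, Finset.sum_mul, Finset.sum_smul, mul_smul] using this.symm
  have hr (c : K) : slice k H (T ∘ₗ LinearMap.mulRight k c) =
      ∑ i, b.repr c i • slice k H (T ∘ₗ LinearMap.mulRight k (b i)) := by
    refine TensorProduct.ext' fun h v => ?_
    have := congrArg (fun z => T (v * z) • h) (b.sum_repr c)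
    simpa [-Module.Basis.sum_repr, Finset.mul_sum, Finset.sum_smul, mul_smul] using this.symm
  rw [hl, hr, b.sum_repr, b.sum_repr]
  conv_lhs => rw [← b.sum_repr y]
  conv_rhs => rw [← b.sum_repr x]
  simp only [map_sum, map_smul, LinearMap.sum_apply, LinearMap.smul_apply, Finset.smul_sum, e1]
  rw [Finset.sum_comm]
  exact Finset.sum_congr rfl fun i _ => Finset.sum_congr rfl fun j _ => smul_comm _ _ _

end LeftComoduleAlgebra

/-! ### Semisimplicity, integrals and finite dimension. -/

open Coalgebra HopfAlgebra

/-- Take e to be the component of 1 in a left ideal complementing the kernel: for r in the kernel, r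
e lies in both ideals. -/
theorem IsSemisimpleRing.exists_map_eq_one_of_ringHom {R F : Type*} [Ring R] [IsSemisimpleRing R]
    [Ring F] (f : R →+* F) : ∃ e : R, f e = 1 ∧ ∀ r, f r = 0 → r * e = 0 := by
  obtain ⟨J, hJ⟩ := exists_isCompl (RingHom.ker f)
  obtain ⟨i, hi, j, hj, hij⟩ := Submodule.mem_sup.1 (hJ.sup_eq_top ▸ Submodule.mem_top (x := (1 : R)))
  rw [RingHom.mem_ker] at hi
  refine ⟨j, ?_, fun r hr => ?_⟩
  · simpa [hi] using congrArg f hij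
  · exact Submodule.disjoint_def.1 hJ.disjoint _ (by simp [RingHom.mem_ker, hr])
      (J.smul_mem r hj)

/-- Write p = ∑ bᵢ ⊗ fᵢ with the bᵢ independent, and let Y be the span of the fᵢ. Invariance puts
every fᵢ x in Y, and x ↦ (fᵢ x) is injective because ∑ bᵢ fᵢ = 1. -/
theorem FiniteDimensional.of_separability {k A : Type*} [Field k] [Ring A] [Algebra k A]
    (p : A ⊗[k] A)
    (hp : ∀ x : A, LinearMap.rTensor A (LinearMap.mulLeft k x) p =
      LinearMap.lTensor A (LinearMap.mulRight k x) p)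
    (hp1 : LinearMap.mul' k A p = 1) : FiniteDimensional k A := by
  classical
  let b := Module.Basis.ofVectorSpace k A
  let e := TensorProduct.equivFinsuppOfBasisLeft (R := k) (M := A) (N := A) b
  let f := e p
  have hpf : p = ∑ i ∈ f.support, b i ⊗ₜ[k] f i := by
    have : e.symm f = p := e.symm_apply_apply p
    rw [← this, TensorProduct.equivFinsuppOfBasisLeft_symm_apply, Finsupp.sum]
  let Y : Submodule k A := Submodule.span k (f '' f.support)
  have hY : FiniteDimensional k Y :=
    FiniteDimensional.span_of_finite k ((Finset.finite_toSet _).image _)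
  have hf (i) (x : A) : f i * x ∈ Y := by
    have h := congrArg (fun t => e t i) (hp x)
    have hr : e (LinearMap.lTensor A (LinearMap.mulRight k x) p) i = f i * x := by
      have : ∀ t, e (LinearMap.lTensor A (LinearMap.mulRight k x) t) i = e t i * x := by
        intro t
        induction t with
        | zero => simp
        | add t t' h h' => simp [h, h', add_mul]
        | tmul a c => simp [e]
      exact this p
    rw [hr] at h
    rw [← h, hpf]
    simp only [map_sum, LinearMap.rTensor_tmul, Finsupp.coe_finsetSum, Finset.sum_apply]
    refine Submodule.sum_mem _ fun j hj => ?_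
    simp only [e, TensorProduct.equivFinsuppOfBasisLeft_apply_tmul_apply]
    exact Y.smul_mem _ (Submodule.subset_span ⟨j, hj, rfl⟩)
  let Φ : A →ₗ[k] f.support → Y := LinearMap.pi fun i =>
    LinearMap.codRestrict Y (LinearMap.mulLeft k (f i)) (hf i)
  refine FiniteDimensional.of_injective Φ ?_
  rw [← LinearMap.ker_eq_bot, LinearMap.ker_eq_bot']
  intro x hx
  have h0 (i) (hi : i ∈ f.support) : f i * x = 0 := congrArg Subtype.val (congrFun hx ⟨i, hi⟩)
  have h1 : LinearMap.mul' k A p * x = 0 := by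
    rw [hpf, map_sum, Finset.sum_mul]
    exact Finset.sum_eq_zero fun i hi => by simp [mul_assoc, h0 i hi]
  simpa [hp1] using h1

namespace HopfAlgebra

variable (k : Type*) (H : Type*) [Field k] [Ring H] [HopfAlgebra k H]

variable {H} in
/-- A two-sided integral `Λ` of a Hopf algebra with `ε(Λ) = 1`. -/
structure IsNormalizedIntegral (Λ : H) : Prop where
  counit_eq_one : counit (R := k) Λ = 1
  mul_left : ∀ h : H, h * Λ = counit (R := k) h • Λ
  mul_right : ∀ h : H, Λ * h = counit (R := k) h • Λ

theorem exists_isNormalizedIntegral [IsSemisimpleRing H] :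
    ∃ Λ : H, IsNormalizedIntegral k Λ := by
  let f : H →+* k := (Bialgebra.counitAlgHom k H : H →+* k)
  have hfε (h : H) : f h = counit (R := k) h := rfl
  obtain ⟨e, he, hl⟩ := IsSemisimpleRing.exists_map_eq_one_of_ringHom f
  obtain ⟨e', he', hr⟩ := IsSemisimpleRing.exists_map_eq_one_of_ringHom
    (f.fromOpposite fun x y => Commute.all _ _)
  have h1 (h : H) : h * e = counit (R := k) h • e := by
    have := hl (h - algebraMap k H (counit h)) (by simp [hfε])
    rwa [sub_mul, sub_eq_zero, ← Algebra.smul_def] at this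
  have h2 (h : H) : e'.unop * h = counit (R := k) h • e'.unop := by
    have := congrArg MulOpposite.unop (hr (MulOpposite.op (h - algebraMap k H (counit h)))
      (by simp [hfε]))
    simpa [mul_sub, sub_eq_zero, ← Algebra.commutes, ← Algebra.smul_def] using this
  -- The product of the right integral e' with the left integral e equals each of them.
  have h3 : e'.unop = e := by
    have := (h1 e'.unop).symm.trans (h2 e)
    rw [← hfε, ← hfε, he, show f e'.unop = 1 from he', one_smul, one_smul] at this
    exact this.symm
  exact ⟨e, he, h1, h3 ▸ h2⟩

/-- The element Λ₁ ⊗ S(Λ₂) is a separability element: x Λ₁ ⊗ S(Λ₂) = x₁Λ₁ ⊗ S(x₂Λ₂) x₃ = Λ₁ ⊗ S(Λ₂)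
x. Below, `G` sends a ⊗ b ⊗ c to aΛ₁ ⊗ S(bΛ₂) c, and the two bracketings of the iterated coproduct
of x give the two ends. -/
theorem finiteDimensional_of_isSemisimpleRing [IsSemisimpleRing H] : FiniteDimensional k H := by
  obtain ⟨Λ, hε, hl, -⟩ := exists_isNormalizedIntegral k H
  let S : H →ₗ[k] H := antipode k
  refine FiniteDimensional.of_separability (LinearMap.lTensor H S (comul Λ)) (fun x => ?_) ?_
  · let q : H ⊗[k] H →ₗ[k] H ⊗[k] H := LinearMap.lTensor H S ∘ₗ LinearMap.mulRight k (comul Λ)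
    let G : (H ⊗[k] H) ⊗[k] H →ₗ[k] H ⊗[k] H := TensorProduct.lift
      ((LinearMap.lTensorHom H ∘ₗ (LinearMap.mul k H).flip).flip ∘ₗ q)
    have hG (t c) : G (t ⊗ₜ c) = LinearMap.lTensor H (LinearMap.mulRight k c) (q t) := rfl
    have hq (h : H) : q (comul h) = counit (R := k) h • LinearMap.lTensor H S (comul Λ) := by
      simp only [q, LinearMap.comp_apply, LinearMap.mulRight_apply]
      rw [← Bialgebra.comul_mul, hl, map_smul, map_smul]
    have h2 (a : H) (s : H ⊗[k] H) : G ((TensorProduct.assoc k H H H).symm (a ⊗ₜ s)) =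
        LinearMap.lTensor H (LinearMap.mulRight k (LinearMap.mul' k H (LinearMap.rTensor H S s)))
          (LinearMap.rTensor H (LinearMap.mulLeft k a) (LinearMap.lTensor H S (comul Λ))) := by
      induction s with
      | zero => simp
      | add s s' h h' =>
        rw [TensorProduct.tmul_add, map_add, map_add, h, h', map_add, map_add, ←
          LinearMap.add_apply, ← LinearMap.lTensor_add]
        congr 2
        ext; simp [mul_add]
      | tmul b c =>
        rw [TensorProduct.assoc_symm_tmul, hG]
        simp only [q, LinearMap.comp_apply, LinearMap.mulRight_apply]
        generalize comul (R := k) Λ = t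
        induction t with
        | zero => simp
        | add t t' h h' => simp only [mul_add, map_add, h, h']
        | tmul u v => simp [S, antipode_mul_antidistrib, mul_assoc]
    let r := Coalgebra.Repr.arbitrary k x
    have hc := congrArg (fun t => G ((TensorProduct.assoc k H H H).symm t)) (coassoc_apply (R := k) x)
    simp only [LinearEquiv.symm_apply_apply] at hc
    rw [← r.eq] at hc
    simp only [map_sum, LinearMap.rTensor_tmul, LinearMap.lTensor_tmul, hG, hq, h2, map_smul] at hc
    have e1 : ∑ i ∈ r.index, counit (R := k) (r.left i) • r.right i = x := sum_counit_smul r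
    have e2 : ∑ i ∈ r.index, counit (R := k) (r.right i) • r.left i = x := by
      simpa [-sum_tmul_counit_eq] using congrArg (TensorProduct.rid k H) (sum_tmul_counit_eq r)
    simp only [show S = antipode k from rfl, mul_antipode_rTensor_comul_apply] at hc
    let P : H →ₗ[k] H ⊗[k] H := (LinearMap.rTensorHom H ∘ₗ LinearMap.mul k H).flip
      (LinearMap.lTensor H S (comul Λ))
    let Q : H →ₗ[k] H ⊗[k] H := (LinearMap.lTensorHom H ∘ₗ (LinearMap.mul k H).flip).flip
      (LinearMap.lTensor H S (comul Λ))
    have hQ (c : k) (z : H ⊗[k] H) :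
        LinearMap.lTensor H (LinearMap.mulRight k (algebraMap k H c)) z = c • z := by
      have : LinearMap.mulRight k (algebraMap k H c) = c • LinearMap.id := by
        ext; simp [← Algebra.commutes, Algebra.smul_def]
      simp [this, LinearMap.lTensor_smul]
    simp only [hQ] at hc
    change P x = Q x
    conv_lhs => rw [← e2]
    conv_rhs => rw [← e1]
    simp only [map_sum, map_smul]
    exact hc.symm
  · rw [mul_antipode_lTensor_comul_apply, hε, map_one]

end HopfAlgebra

/-- A Hopf algebra as a left comodule algebra over itself. -/
noncomputable def LeftComoduleAlgebra.self (k : Type*) (H : Type*) [Field k] [Ring H]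
    [HopfAlgebra k H] : LeftComoduleAlgebra k H H where
  coact := Bialgebra.comulAlgHom k H
  coassoc := coassoc_apply
  counit_coact := rTensor_counit_comul

/-! ### The twisted trace form on H: nondegeneracy and uniqueness. -/

namespace HopfAlgebra

open LeftComoduleAlgebra

variable {k : Type*} {H : Type*} [Field k] [Ring H] [HopfAlgebra k H]

@[simp]
theorem self_coact (x : H) : (LeftComoduleAlgebra.self k H).coact x = comul x := rfl

theorem eq_sum_counit_smul_coeff {ι : Type*} [Fintype ι] (b : Module.Basis ι k H) (i : ι) :
    b i = ∑ j, counit (R := k) (b j) • (LeftComoduleAlgebra.self k H).coeff b i j := by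
  have h := lTensor_counit_comul (R := k) (b i)
  rw [← self_coact, coact_basis] at h
  simpa using (congrArg (TensorProduct.rid k H) h).symm

theorem linearMap_ext_coeff {ι V : Type*} [Fintype ι] [AddCommGroup V] [Module k V]
    (b : Module.Basis ι k H)
    {f g : H →ₗ[k] V} (h : ∀ i j, f ((LeftComoduleAlgebra.self k H).coeff b i j) =
      g ((LeftComoduleAlgebra.self k H).coeff b i j)) : f = g :=
  b.ext fun i => by rw [eq_sum_counit_smul_coeff b i]; simp [h]

/-- The linear form `x ↦ Tr (y ↦ x S²(y))`. -/
noncomputable def sqTrace (k H : Type*) [Field k] [Ring H] [HopfAlgebra k H] : H →ₗ[k] k :=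
  traceForm H (antipode k ∘ₗ antipode k)

theorem sqTrace_mul (x y : H) :
    sqTrace k H (x * y) = sqTrace k H (y * antipode k (antipode k x)) := by
  simp only [sqTrace, traceForm_apply]
  have e1 : LinearMap.mulLeft k (x * y) ∘ₗ antipode k ∘ₗ antipode k =
      LinearMap.mulLeft k x * (LinearMap.mulLeft k y ∘ₗ antipode k ∘ₗ antipode k) := by
    ext; simp
  have e2 : LinearMap.mulLeft k (y * antipode k (antipode k x)) ∘ₗ antipode k ∘ₗ antipode k =
      (LinearMap.mulLeft k y ∘ₗ antipode k ∘ₗ antipode k) * LinearMap.mulLeft k x := by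
    ext; simp [antipode_mul_antidistrib]
  rw [e1, LinearMap.trace_mul_comm, e2]

variable {Λ : H}

theorem sqTrace_integral_mul (hΛ : IsNormalizedIntegral k Λ) (x : H) :
    sqTrace k H (Λ * x) = counit (R := k) x * sqTrace k H Λ := by simp [hΛ.mul_right]

variable [FiniteDimensional k H]

theorem comul_antipode (x : H) : comul (R := k) (antipode k x) =
    TensorProduct.comm k H H (TensorProduct.map (antipode k) (antipode k) (comul x)) := by
  let b := Module.finBasis k H
  let c := (LeftComoduleAlgebra.self k H).coeff b
  suffices comul ∘ₗ antipode k = (TensorProduct.comm k H H).toLinearMap ∘ₗ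
      TensorProduct.map (antipode k) (antipode k) ∘ₗ comul (R := k) (A := H) from
    LinearMap.congr_fun this x
  refine linearMap_ext_coeff b fun i j => ?_
  -- Both candidates for the coproduct of S(c) are inverse to the matrix Δ(c): X on the left, Y on
  -- the right.
  let X : Matrix _ _ (H ⊗[k] H) := Matrix.of fun i j => comul (R := k) (antipode k (c i j))
  let Y : Matrix _ _ (H ⊗[k] H) := Matrix.of fun i j =>
    ∑ l, antipode k (c l j) ⊗ₜ[k] antipode k (c i l)
  let Z : Matrix _ _ (H ⊗[k] H) := Matrix.of fun i j => comul (R := k) (c i j)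
  have h1 : X * Z = 1 := by
    ext i j
    simp only [X, Z, Matrix.mul_apply, Matrix.of_apply, ← Bialgebra.comul_mul, ← map_sum, c,
      sum_antipode_coeff_mul_coeff, Matrix.one_apply]
    split_ifs <;> simp
  have h2 : Z * Y = 1 := by
    ext i j
    simp only [Y, Z, Matrix.mul_apply, Matrix.of_apply, c, comul_coeff, Finset.sum_mul,
      Finset.mul_sum, Algebra.TensorProduct.tmul_mul_tmul]
    rw [Finset.sum_congr rfl fun l _ => Finset.sum_comm, Finset.sum_comm]
    have this (p) : ∑ l, ∑ q, ((self k H).coeff b i p * antipode k ((self k H).coeff b q j)) ⊗ₜ[k]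
        ((self k H).coeff b p l * antipode k ((self k H).coeff b l q)) =
        ((self k H).coeff b i p * antipode k ((self k H).coeff b p j)) ⊗ₜ[k] (1 : H) := by
      rw [Finset.sum_comm]
      simp only [← TensorProduct.tmul_sum, sum_coeff_mul_antipode_coeff]
      simp [apply_ite]
    simp only [this, ← TensorProduct.sum_tmul, sum_coeff_mul_antipode_coeff, Matrix.one_apply]
    split_ifs <;> simp [Algebra.TensorProduct.one_def]
  have h3 := congrFun (congrFun (left_inv_eq_right_inv h1 h2 : X = Y) i) j
  simpa [X, Y, c, comul_coeff] using h3

theorem comul_antipode_antipode (x : H) : comul (R := k) (antipode k (antipode k x)) =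
    TensorProduct.map (antipode k ∘ₗ antipode k) (antipode k ∘ₗ antipode k) (comul x) := by
  rw [comul_antipode, comul_antipode]
  generalize comul (R := k) x = t
  induction t with
  | zero => simp
  | add t t' h h' => simp only [map_add, h, h']
  | tmul u v => simp

theorem isCoinvariant_sqTrace : (LeftComoduleAlgebra.self k H).IsCoinvariant (sqTrace k H) :=
  isCoinvariant_traceForm _ _ comul_antipode_antipode

theorem sqTrace_integral (hΛ : IsNormalizedIntegral k Λ) : sqTrace k H Λ = 1 := by
  rw [sqTrace, traceForm_apply]
  have : LinearMap.mulLeft k Λ ∘ₗ antipode k ∘ₗ antipode k =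
      (counit (R := k) (A := H)).smulRight Λ := by
    ext; simp [hΛ.mul_right]
  rw [this, LinearMap.trace_smulRight, hΛ.counit_eq_one]

/-- By `slice_mulLeft_coact` the left side is y₁ T(Λ y₂) = y₁ ε(y₂) T(Λ). This one formula yields
surjectivity of S and nondegeneracy of T. -/
theorem antipode_slice_sqTrace (hΛ : IsNormalizedIntegral k Λ) (y : H) :
    antipode k (slice k H (sqTrace k H ∘ₗ LinearMap.mulRight k y) (comul Λ)) = y := by
  rw [← self_coact, ← isCoinvariant_sqTrace.slice_mulLeft_coact]
  have : sqTrace k H ∘ₗ LinearMap.mulLeft k Λ = counit := by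
    ext x
    simp [sqTrace_integral_mul hΛ, sqTrace_integral hΛ]
  rw [this, slice, self_coact, LinearMap.comp_apply, lTensor_counit_comul]
  simp

theorem antipode_bijective (hΛ : IsNormalizedIntegral k Λ) : Function.Bijective (antipode k (A := H)) := by
  have : Function.Surjective (antipode k (A := H)) :=
    fun y => ⟨_, antipode_slice_sqTrace hΛ y⟩
  exact ⟨LinearMap.injective_iff_surjective.2 this, this⟩

theorem eq_zero_of_sqTrace_mul_right (hΛ : IsNormalizedIntegral k Λ) {y : H} (h : ∀ x, sqTrace k H (x * y) = 0) : y = 0 := by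
  rw [← antipode_slice_sqTrace hΛ y]
  have : sqTrace k H ∘ₗ LinearMap.mulRight k y = 0 := by ext; simp [h]
  simp [this, slice]

theorem eq_zero_of_sqTrace_mul_left (hΛ : IsNormalizedIntegral k Λ) {x : H} (h : ∀ y, sqTrace k H (x * y) = 0) : x = 0 := by
  have : antipode k (antipode k x) = 0 :=
    eq_zero_of_sqTrace_mul_right hΛ fun y => by rw [← sqTrace_mul, h]
  have hS := (antipode_bijective hΛ).1
  exact (map_eq_zero_iff _ hS).1 ((map_eq_zero_iff _ hS).1 this)

theorem eq_smul_sqTrace_of_isCoinvariant (hΛ : IsNormalizedIntegral k Λ) {θ : H →ₗ[k] k}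
    (hθ : (LeftComoduleAlgebra.self k H).IsCoinvariant θ) : θ = θ Λ • sqTrace k H := by
  have key : ∀ θ : H →ₗ[k] k, (LeftComoduleAlgebra.self k H).IsCoinvariant θ → θ Λ = 0 →
      θ = 0 := by
    intro θ hθ h0
    let Φ : H →ₗ[k] (H →ₗ[k] k) := (LinearMap.mul k H).compr₂ (sqTrace k H)
    have hΦ : Function.Injective Φ := by
      rw [← LinearMap.ker_eq_bot, LinearMap.ker_eq_bot']
      exact fun x hx => eq_zero_of_sqTrace_mul_left hΛ fun y => LinearMap.congr_fun hx y
    obtain ⟨w, hw⟩ := (LinearMap.injective_iff_surjective_of_finrank_eq_finrank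
      (Subspace.dual_finrank_eq (K := k) (V := H)).symm).1 hΦ θ
    -- With θ = T(w ·) = T(· S²(w)), the element S(Λ₁ θ(Λ₂)) is 0 by coinvariance and S²(w) by
    -- `antipode_slice_sqTrace`.
    have h1 : antipode k (slice k H θ (comul Λ)) = 0 := by
      rw [← self_coact, hθ, h0, zero_smul, map_zero]
    have h2 : θ = sqTrace k H ∘ₗ LinearMap.mulRight k (antipode k (antipode k w)) := by
      rw [← hw]
      exact LinearMap.ext fun x => sqTrace_mul w x
    rw [h2, antipode_slice_sqTrace hΛ] at h1
    rw [h2, h1]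
    ext; simp
  rw [← sub_eq_zero]
  refine key _ (fun x => ?_) (by simp [sqTrace_integral hΛ])
  have hs : slice k H (θ - θ Λ • sqTrace k H) =
      slice k H θ - θ Λ • slice k H (sqTrace k H) :=
    TensorProduct.ext' fun h v => by simp [sub_smul, mul_smul]
  rw [hs, LinearMap.sub_apply, LinearMap.smul_apply, hθ, isCoinvariant_sqTrace]
  simp [sub_smul, mul_smul]

end HopfAlgebra

/-! ### The modular element and the finite order of S². -/

namespace HopfAlgebra

open LeftComoduleAlgebra

variable {k : Type*} {H : Type*} [Field k] [Ring H] [HopfAlgebra k H]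

/-- The linear map `V ⊗ W → W`, `v ⊗ w ↦ φ v • w`. -/
noncomputable def coslice {V W : Type*} [AddCommGroup V] [Module k V] [AddCommGroup W]
    [Module k W] (φ : V →ₗ[k] k) : V ⊗[k] W →ₗ[k] W :=
  (TensorProduct.lid k W).toLinearMap ∘ₗ LinearMap.rTensor W φ

@[simp]
theorem coslice_tmul {V W : Type*} [AddCommGroup V] [Module k V] [AddCommGroup W]
    [Module k W] (φ : V →ₗ[k] k) (v : V) (w : W) : coslice φ (v ⊗ₜ[k] w) = φ v • w := by
  simp [coslice]

variable [FiniteDimensional k H] {Λ : H}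

variable (k) in
/-- The element `T(Λ₁) Λ₂` where `T` is the trace form `sqTrace`; it governs the failure of `T`
to be coinvariant on the right. -/
noncomputable def modularElement (Λ : H) : H := coslice (sqTrace k H) (comul Λ)

/-- For every form φ, x ↦ T(x₁) φ(x₂) is coinvariant, hence a multiple of T; evaluation at Λ gives
the factor φ(g). -/
theorem coslice_sqTrace (hΛ : IsNormalizedIntegral k Λ) (x : H) :
    coslice (sqTrace k H) (comul x) = sqTrace k H x • modularElement k Λ := by
  let b := Module.finBasis k H
  let c := (LeftComoduleAlgebra.self k H).coeff b
  have key (φ : H →ₗ[k] k) : (LeftComoduleAlgebra.self k H).IsCoinvariant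
      (φ ∘ₗ coslice (sqTrace k H) ∘ₗ comul) := by
    refine isCoinvariant_of_basis b fun m => ?_
    have hb (n) : (φ ∘ₗ coslice (sqTrace k H) ∘ₗ comul) (b n) =
        ∑ p, φ (b p) * sqTrace k H (c n p) := by
      simp only [LinearMap.comp_apply]
      rw [← self_coact, coact_basis]
      simp [c, mul_comm]
    simp only [hb, Finset.sum_smul, mul_smul]
    rw [Finset.sum_comm]
    refine Finset.sum_congr rfl fun p _ => ?_
    rw [← Finset.smul_sum, ← isCoinvariant_sqTrace, self_coact, comul_coeff]
    simp [c]
  rw [← sub_eq_zero, ← Module.forall_dual_apply_eq_zero_iff k]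
  intro φ
  have h := LinearMap.congr_fun (eq_smul_sqTrace_of_isCoinvariant hΛ (key φ)) x
  simp only [LinearMap.comp_apply, LinearMap.smul_apply, smul_eq_mul] at h
  simp [h, modularElement, mul_comm]

theorem isGroupLikeElem_modularElement (hΛ : IsNormalizedIntegral k Λ) :
    IsGroupLikeElem k (modularElement k Λ) := by
  let b := Module.finBasis k H
  let c := (LeftComoduleAlgebra.self k H).coeff b
  let g := modularElement k Λ
  have hT := sqTrace_integral hΛ
  constructor
  · have : ∀ t : H ⊗[k] H, counit (R := k) (coslice (sqTrace k H) t) =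
        sqTrace k H (TensorProduct.rid k H (LinearMap.lTensor H counit t)) := by
      intro t
      induction t with
      | zero => simp
      | add t t' h h' => simp only [map_add, h, h']
      | tmul u v => simp [mul_comm]
    rw [modularElement, this, lTensor_counit_comul]
    simpa using hT
  · have h1 : (comul (R := k) ∘ₗ coslice (sqTrace k H) ∘ₗ comul) =
        (sqTrace k H).smulRight (g ⊗ₜ[k] g) := by
      refine b.ext fun m => ?_
      have h2 (p) : ∑ n, sqTrace k H (c m n) • c n p = sqTrace k H (c m p) • g := by
        rw [← coslice_sqTrace hΛ, comul_coeff]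
        simp [c]
      have h3 : ∑ n, sqTrace k H (c m n) • b n = sqTrace k H (b m) • g := by
        rw [← coslice_sqTrace hΛ, ← self_coact, coact_basis]
        simp [c]
      simp only [LinearMap.comp_apply, LinearMap.smulRight_apply]
      rw [coslice_sqTrace hΛ, ← h3, map_sum]
      have h4 (n) : comul (R := k) (b n) = ∑ p, c n p ⊗ₜ[k] b p := coact_basis (self k H) b n
      simp only [map_smul, h4, Finset.smul_sum, TensorProduct.smul_tmul']
      rw [Finset.sum_comm]
      simp only [← TensorProduct.sum_tmul, h2]
      rw [TensorProduct.smul_tmul, ← h3, TensorProduct.tmul_sum]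
      simp only [TensorProduct.smul_tmul]
    have h5 := LinearMap.congr_fun h1 Λ
    simpa [hT, coslice_sqTrace hΛ] using h5

/-- If S(y) = Λ then ε(y) = 1, so S(Λ) = S(yΛ) = S(Λ)Λ = Λ. -/
theorem antipode_integral (hΛ : IsNormalizedIntegral k Λ) : antipode k Λ = Λ := by
  obtain ⟨y, hy⟩ := (antipode_bijective hΛ).2 Λ
  have hεy : counit (R := k) y = 1 := by rw [← counit_antipode, hy, hΛ.counit_eq_one]
  have h1 : antipode k Λ * Λ = Λ := by
    rw [hΛ.mul_left, counit_antipode, hΛ.counit_eq_one, one_smul]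
  have h2 := antipode_mul_antidistrib (R := k) y Λ
  rw [hΛ.mul_left, hεy, one_smul, hy, h1] at h2
  exact h2

theorem sqTrace_antipode_mul_modularElement (hΛ : IsNormalizedIntegral k Λ) (x : H) :
    sqTrace k H (antipode k x * modularElement k Λ) = sqTrace k H x := by
  have hg := isGroupLikeElem_modularElement hΛ
  let g := modularElement k Λ
  let θ : H →ₗ[k] k := sqTrace k H ∘ₗ LinearMap.mulRight k g ∘ₗ antipode k
  have hθ : (LeftComoduleAlgebra.self k H).IsCoinvariant θ := by
    intro x
    apply (antipode_bijective hΛ).1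
    have h1 := coslice_sqTrace hΛ (antipode k x * g)
    have h2 : ∀ t : H ⊗[k] H, coslice (sqTrace k H) (TensorProduct.comm k H H
        (TensorProduct.map (antipode k) (antipode k) t) * (g ⊗ₜ[k] g)) =
        antipode k (slice k H θ t) * g := by
      intro t
      induction t with
      | zero => simp
      | add t t' h h' => simp only [map_add, add_mul, h, h']
      | tmul u v => simp [θ]
    rw [Bialgebra.comul_mul, comul_antipode, hg.comul_eq_tmul_self, h2] at h1
    have h3 := congrArg (· * antipode k g) h1
    simpa [mul_assoc, hg.mul_antipode_cancel, g, θ, antipode_one] using h3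
  have h1 := eq_smul_sqTrace_of_isCoinvariant hΛ hθ
  have h2 : θ Λ = 1 := by
    simp [θ, antipode_integral hΛ, g, hΛ.mul_right, hg.counit_eq_one, sqTrace_integral hΛ]
  rw [h2, one_smul] at h1
  exact LinearMap.congr_fun h1 x

/-- Radford's formula, with a single grouplike because Λ is two-sided. With w = g S²(y) g⁻¹,
applying T(S(·) g) = T gives T(xy) = T(wx) = T(x S²(w)), so y = S²(w) by nondegeneracy. -/
theorem antipode_pow_four (hΛ : IsNormalizedIntegral k Λ) (y : H) :
    modularElement k Λ * antipode k (antipode k (antipode k (antipode k y))) =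
      y * modularElement k Λ := by
  have hg := isGroupLikeElem_modularElement hΛ
  set g := modularElement k Λ with hgdef
  have hSg : antipode k (antipode k g) = g := hg.antipode_antipode
  have hg2 : antipode k g * g = 1 := hg.antipode_mul_cancel
  let w := g * antipode k (antipode k y) * antipode k g
  have hw : antipode k w * g = g * antipode k (antipode k (antipode k y)) := by
    simp only [w, antipode_mul_antidistrib, hSg]
    simp [mul_assoc, hg2]
  have hT (x : H) : sqTrace k H (x * y) = sqTrace k H (w * x) := by
    rw [← sqTrace_antipode_mul_modularElement hΛ (x * y),
      ← sqTrace_antipode_mul_modularElement hΛ (w * x), antipode_mul_antidistrib,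
      antipode_mul_antidistrib, ← hgdef, mul_assoc, sqTrace_mul, mul_assoc, mul_assoc, hw]
  have h := eq_zero_of_sqTrace_mul_right hΛ (y := y - antipode k (antipode k w)) fun x => by
    rw [mul_sub, map_sub, hT, ← sqTrace_mul, sub_self]
  rw [sub_eq_zero] at h
  conv_rhs => rw [h]
  simp only [w, antipode_mul_antidistrib, hSg]
  simp [mul_assoc, hg2]

theorem modularElement_eq_one (hΛ : IsNormalizedIntegral k Λ) (h : sqTrace k H 1 ≠ 0) :
    modularElement k Λ = 1 := by
  have h1 := coslice_sqTrace hΛ 1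
  rw [Bialgebra.comul_one, Algebra.TensorProduct.one_def, coslice_tmul] at h1
  exact (smul_right_injective H h h1).symm

/-- The square of the antipode has finite order. -/
theorem exists_pow_antipode_sq_eq_one (hΛ : IsNormalizedIntegral k Λ) :
    ∃ M : ℕ, 0 < M ∧ ((antipode k ∘ₗ antipode k : Module.End k H)) ^ M = 1 := by
  have hg := isGroupLikeElem_modularElement hΛ
  set g := modularElement k Λ
  -- Grouplike elements are linearly independent, hence finite in number, so two powers of g
  -- coincide.
  obtain ⟨N, hN, hgN⟩ : ∃ N : ℕ, 0 < N ∧ g ^ N = 1 := by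
    have hfin : {a : H | IsGroupLikeElem k a}.Finite :=
      (linearIndepOn_isGroupLikeElem (R := k) (A := H)).setFinite
    have := hfin.to_subtype
    obtain ⟨i, j, hij, hgij⟩ := Finite.exists_ne_map_eq_of_infinite
      fun n : ℕ => (⟨g ^ n, hg.pow⟩ : {a : H | IsGroupLikeElem k a})
    have h : g ^ i = g ^ j := congrArg Subtype.val hgij
    clear hgij
    wlog hlt : i < j generalizing i j
    · exact this j i hij.symm h.symm (by lia)
    refine ⟨j - i, by omega, ?_⟩
    refine (hg.isUnit.pow i).mul_left_cancel ?_
    rw [← pow_add, mul_one, h]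
    congr 1
    omega
  refine ⟨2 * N, by omega, ?_⟩
  have hE (n : ℕ) (y : H) : g ^ n * ((antipode k ∘ₗ antipode k : Module.End k H) ^ (2 * n)) y =
      y * g ^ n := by
    induction n generalizing y with
    | zero => simp
    | succ n ih =>
      rw [mul_add, pow_add _ (2 * n), Module.End.mul_apply, pow_succ' g, mul_assoc, ih,
        ← mul_assoc]
      have := antipode_pow_four hΛ y
      simp only [mul_one, pow_two, Module.End.mul_apply, LinearMap.comp_apply] at this ⊢
      rw [this, mul_assoc, ← pow_succ' g]
  ext y
  simpa [hgN] using hE N y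

end HopfAlgebra

/-! ### Nonvanishing of the trace of a twisting automorphism. -/

/-- Roots of unity lie in the algebraic closure of ℚ in k, which embeds in ℂ; there inversion is
conjugation, so the hypothesis is a vanishing sum of squared absolute values. -/
theorem sum_eq_zero_of_sum_sum_mul_sum_inv_eq_zero {k : Type*} [Field k] [CharZero k] {ι : Type*}
    [Fintype ι] {κ : ι → Type*} [∀ i, Fintype (κ i)] (s : ∀ i, κ i → k) {M : ℕ} (hM : 0 < M)
    (hs : ∀ i j, s i j ^ M = 1) (h : ∑ i, (∑ j, s i j) * ∑ j, (s i j)⁻¹ = 0) (i : ι) :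
    ∑ j, s i j = 0 := by
  let F := algebraicClosure ℚ k
  have hF (i j) : s i j ∈ F := by
    rw [mem_algebraicClosure_iff]
    exact IsIntegral.isAlgebraic (IsIntegral.of_pow hM (by rw [hs]; exact isIntegral_one))
  have : Algebra.IsAlgebraic ℚ F := algebraicClosure.isAlgebraic ℚ k
  let φ : F →ₐ[ℚ] ℂ := IsAlgClosed.lift
  let t (i) (j : κ i) : F := ⟨s i j, hF i j⟩
  have ht (i j) : φ (t i j) ^ M = 1 := by
    rw [← map_pow, ← map_one φ]
    congr 1
    exact Subtype.ext (hs i j)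
  have hinv (i j) : φ (t i j)⁻¹ = (starRingEnd ℂ) (φ (t i j)) := by
    rw [map_inv₀, Complex.inv_eq_conj]
    exact Complex.norm_eq_one_of_pow_eq_one (ht i j) hM.ne'
  have h0 : ∑ i, (∑ j, t i j) * ∑ j, (t i j)⁻¹ = 0 := Subtype.ext (by simpa [t] using h)
  have h1 : ∑ i, Complex.normSq (φ (∑ j, t i j)) = 0 := by
    have := congrArg φ h0
    simp only [map_sum, map_mul, hinv, map_zero] at this
    simp only [← map_sum, Complex.mul_conj] at this
    exact_mod_cast this
  have h2 := (Finset.sum_eq_zero_iff_of_nonneg fun i _ => Complex.normSq_nonneg _).1 h1 i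
    (Finset.mem_univ i)
  rw [Complex.normSq_eq_zero, map_eq_zero] at h2
  simpa [t] using congrArg Subtype.val h2

namespace Matrix

/-- Since X^M - c is separable, U is diagonalizable; its eigenvalues are M-th roots of unity times a
fixed r with r^M = c. -/
theorem exists_trace_eq_of_pow_eq_smul {k : Type*} [Field k] [IsAlgClosed k] [CharZero k]
    {n : Type*} [Fintype n] [DecidableEq n] (U V : Matrix n n k) (hVU : V * U = 1) {M : ℕ}
    (hM : 0 < M) {c : k} (hc : c ≠ 0) (hU : U ^ M = c • (1 : Matrix n n k)) :
    ∃ (r : k) (s : n → k), r ≠ 0 ∧ (∀ j, s j ^ M = 1) ∧ U.trace = r * ∑ j, s j ∧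
      V.trace = r⁻¹ * ∑ j, (s j)⁻¹ := by
  let f : Module.End k (n → k) := Matrix.toLin' U
  have hfM : f ^ M = c • 1 := by
    rw [← Matrix.toLin'_pow, hU, map_smul, Matrix.toLin'_one]; rfl
  have hss : f.IsSemisimple := by
    refine Module.End.isSemisimple_of_squarefree_aeval_eq_zero (p := Polynomial.X ^ M -
      Polynomial.C c) (Polynomial.separable_X_pow_sub_C c (by exact_mod_cast hM.ne') hc).squarefree ?_
    simp [hfM, Algebra.algebraMap_eq_smul_one]
  let S : Set (n → k) := {v | ∃ μ : k, f v = μ • v}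
  have hS : ⊤ ≤ Submodule.span k S := by
    rw [← hss.iSup_eigenspace_eq_top, iSup_le_iff]
    exact fun μ v hv => Submodule.subset_span ⟨μ, Module.End.mem_eigenspace_iff.1 hv⟩
  let b₀ := Module.Basis.ofSpan hS
  let b := b₀.reindex (b₀.indexEquiv (Pi.basisFun k n))
  have hb (j) : ∃ μ : k, f (b j) = μ • b j := by
    refine Module.Basis.ofSpan_subset hS ?_
    exact ⟨_, (b₀.reindex_apply _ j).symm⟩
  choose μ hμ using hb
  have hpow (m : ℕ) (j) : (f ^ m) (b j) = μ j ^ m • b j := by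
    induction m with
    | zero => simp
    | succ m ih => rw [pow_succ', Module.End.mul_apply, ih, map_smul, hμ, smul_smul, pow_succ]
  have hμM (j) : μ j ^ M = c := by
    have := hpow M j
    rw [hfM] at this
    exact (smul_left_injective k (b.ne_zero j) this).symm
  have hμ0 (j) : μ j ≠ 0 := by
    intro h
    apply hc
    rw [← hμM j, h, zero_pow hM.ne']
  have hV (j) : Matrix.toLin' V (b j) = (μ j)⁻¹ • b j := by
    have h1 : Matrix.toLin' V (f (b j)) = b j := by
      rw [← LinearMap.comp_apply, ← Matrix.toLin'_mul, hVU, Matrix.toLin'_one, LinearMap.id_apply]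
    rw [hμ, map_smul] at h1
    rw [eq_inv_smul_iff₀ (hμ0 j), h1]
  obtain ⟨r, hr⟩ := IsAlgClosed.exists_pow_nat_eq c hM
  have hr0 : r ≠ 0 := by
    rintro rfl
    exact hc (by rw [← hr, zero_pow hM.ne'])
  refine ⟨r, fun j => μ j / r, hr0, fun j => ?_, ?_, ?_⟩
  · rw [div_pow, hμM, hr, div_self hc]
  · rw [← Matrix.trace_toLin'_eq, LinearMap.trace_eq_matrix_trace k b, Finset.mul_sum]
    refine Finset.sum_congr rfl fun j _ => ?_
    rw [Matrix.diag_apply, LinearMap.toMatrix_apply, show Matrix.toLin' U (b j) = _ from hμ j]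
    simp [mul_div_cancel₀ _ hr0]
  · rw [← Matrix.trace_toLin'_eq, LinearMap.trace_eq_matrix_trace k b, Finset.mul_sum]
    refine Finset.sum_congr rfl fun j _ => ?_
    rw [Matrix.diag_apply, LinearMap.toMatrix_apply, hV]
    simp [hr0, div_eq_mul_inv]

theorem exists_linearMap_pi_eq_trace {k : Type*} [Field k] {ι : Type*} [Fintype ι] [DecidableEq ι]
    {κ : ι → Type*} [∀ i, Fintype (κ i)] [∀ i, DecidableEq (κ i)]
    (f : (∀ i, Matrix (κ i) (κ i) k) →ₗ[k] k) :
    ∃ U : ∀ i, Matrix (κ i) (κ i) k, ∀ X, f X = ∑ i, (X i * U i).trace := by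
  refine ⟨fun i => Matrix.of fun a b => f (Pi.single i (Matrix.single b a 1)), fun X => ?_⟩
  conv_lhs => rw [← Finset.univ_sum_single X, map_sum]
  refine Finset.sum_congr rfl fun i _ => ?_
  conv_lhs => rw [Matrix.matrix_eq_sum_single (X i)]
  have h (a b) : f (Pi.single i (Matrix.single a b (X i a b))) =
      X i a b * f (Pi.single i (Matrix.single a b 1)) := by
    rw [← smul_eq_mul, ← map_smul, ← Pi.single_smul, Matrix.smul_single, smul_eq_mul, mul_one]
  have h' : f (Pi.single i (∑ a, ∑ b, Matrix.single a b (X i a b))) =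
      ∑ a, ∑ b, f (Pi.single i (Matrix.single a b (X i a b))) := by
    change (f ∘ₗ LinearMap.single k (fun i => Matrix (κ i) (κ i) k) i) _ = _
    simp only [map_sum]
    rfl
  simp [h', h, Matrix.trace, Matrix.mul_apply]

theorem trace_mul_mul_pi {k : Type*} [Field k] {ι : Type*} [Fintype ι] [DecidableEq ι]
    {κ : ι → Type*} [∀ i, Fintype (κ i)] [∀ i, DecidableEq (κ i)]
    (U V : ∀ i, Matrix (κ i) (κ i) k) :
    LinearMap.trace k _ (LinearMap.mulLeft k U ∘ₗ LinearMap.mulRight k V) =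
      ∑ i, (U i).trace * (V i).trace := by
  rw [LinearMap.trace_eq_matrix_trace k (Pi.basis fun i => Matrix.stdBasis k (κ i) (κ i))]
  simp only [Matrix.trace, Matrix.diag_apply, LinearMap.toMatrix_apply, Fintype.sum_sigma]
  refine Finset.sum_congr rfl fun i _ => ?_
  rw [Fintype.sum_prod_type, Finset.sum_mul_sum]
  refine Finset.sum_congr rfl fun a _ => Finset.sum_congr rfl fun b _ => ?_
  simp only [Pi.basis_apply, Matrix.stdBasis_eq_single, LinearMap.comp_apply,
    LinearMap.mulLeft_apply, LinearMap.mulRight_apply, Pi.basis_repr, Pi.mul_apply,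
    Pi.single_eq_same]
  rw [Matrix.stdBasis, Module.Basis.map_repr, LinearEquiv.trans_apply]
  simp [Pi.basis_repr, Matrix.mul_apply, Matrix.single_apply, ite_and]

end Matrix

theorem trace_ne_zero_of_twisted_form {k B : Type*} [Field k] [IsAlgClosed k] [CharZero k]
    [Ring B] [Algebra k B] [FiniteDimensional k B] [IsSemisimpleRing B] (E : Module.End k B)
    {M : ℕ} (hM : 0 < M) (hE : E ^ M = 1) (T : B →ₗ[k] k) (hT : ∀ x y, T (x * y) = T (y * E x))
    (hnd : ∀ y, (∀ x, T (y * x) = 0) → y = 0) {z : B} (hz : ∀ x, z * x = x * z) (hTz : T z ≠ 0) :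
    LinearMap.trace k B E ≠ 0 := by
  classical
  obtain ⟨n, d, hd, ⟨φ⟩⟩ := IsSemisimpleRing.exists_algEquiv_pi_matrix_of_isAlgClosed k B
  let τ : B → k := fun x => ∑ i, (φ x i).trace
  have hτ (x y) : τ (x * y) = τ (y * x) := by
    simp only [τ, map_mul, Pi.mul_apply]
    exact Finset.sum_congr rfl fun i _ => Matrix.trace_mul_comm _ _
  have hτ0 (y) (h : ∀ x, τ (x * y) = 0) : y = 0 := by
    rw [← map_eq_zero_iff φ φ.injective]
    ext i a b
    have := h (φ.symm (Pi.single i (Matrix.single b a 1)))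
    simp only [τ, map_mul, AlgEquiv.apply_symm_apply, Pi.mul_apply] at this
    rw [Finset.sum_eq_single i (fun j _ hj => by simp [Pi.single_eq_of_ne hj]) (by simp)] at this
    simpa [Matrix.trace_single_mul] using this
  obtain ⟨U₀, hU₀⟩ := Matrix.exists_linearMap_pi_eq_trace (T ∘ₗ φ.symm.toLinearMap)
  -- The form is T = τ(· u) for the sum τ of the block traces, so the twist E is conjugation by u.
  let u := φ.symm U₀
  have hu (x) : T x = τ (x * u) := by
    have := hU₀ (φ x)
    simpa [τ, u] using this
  have hτsub (x y) : τ (x - y) = τ x - τ y := by simp [τ]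
  have hEu (x) : u * x = E x * u := by
    rw [← sub_eq_zero]
    refine hτ0 _ fun y => ?_
    rw [mul_sub, hτsub, ← mul_assoc, hτ, ← mul_assoc, ← hu, hT, hu, mul_assoc, sub_self]
  have hinj : Function.Injective (LinearMap.mulLeft k u) := by
    rw [← LinearMap.ker_eq_bot, LinearMap.ker_eq_bot']
    intro y hy
    refine hnd y fun x => ?_
    rw [hu, hτ, ← mul_assoc, show u * y = 0 from hy, zero_mul]
    simp [τ]
  obtain ⟨v, huv⟩ := LinearMap.injective_iff_surjective.1 hinj 1
  replace huv : u * v = 1 := huv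
  have hvu : v * u = 1 := hinj (by simp [← mul_assoc, huv])
  have hEx (x) : E x = u * x * v := by rw [hEu, mul_assoc, huv, mul_one]
  -- As E^M = 1, the power u^M is central, hence a scalar on each block.
  have hcomm (x) : u ^ M * x = x * u ^ M := by
    have (m : ℕ) (x) : u ^ m * x = (E ^ m) x * u ^ m := by
      induction m generalizing x with
      | zero => simp
      | succ m ih =>
        rw [pow_succ, mul_assoc, hEu, ← mul_assoc, ih, pow_succ E, Module.End.mul_apply, mul_assoc]
    simpa [hE] using this M x
  have hscalar (w : B) (hw : ∀ x, w * x = x * w) (i) : ∃ c : k, φ w i = c • 1 := by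
    have : φ w i ∈ Set.range (Matrix.scalar (Fin (d i))) := by
      refine Matrix.mem_range_scalar_of_commute_single fun a b _ => ?_
      have := congrArg (fun x => φ x i) (hw (φ.symm (Pi.single i (Matrix.single a b 1))))
      simpa [Commute, SemiconjBy] using this.symm
    obtain ⟨c, hc⟩ := this
    exact ⟨c, by rw [← hc, Matrix.scalar_apply, Matrix.smul_one_eq_diagonal]⟩
  intro htr
  have htr' : ∑ i, (φ u i).trace * (φ v i).trace = 0 := by
    rw [← Matrix.trace_mul_mul_pi, ← htr, ← LinearMap.trace_conj' E φ.toLinearEquiv]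
    congr 1
    refine LinearMap.ext fun X => ?_
    simp [LinearEquiv.conj_apply, hEx, mul_assoc]
  have hspec (i) : ∃ (r : k) (s : Fin (d i) → k), r ≠ 0 ∧ (∀ j, s j ^ M = 1) ∧
      (φ u i).trace = r * ∑ j, s j ∧ (φ v i).trace = r⁻¹ * ∑ j, (s j)⁻¹ := by
    obtain ⟨c, hc⟩ := hscalar _ hcomm i
    have hvui : φ v i * φ u i = 1 := by rw [← Pi.mul_apply, ← map_mul, hvu, map_one]; rfl
    rw [map_pow, Pi.pow_apply] at hc
    refine Matrix.exists_trace_eq_of_pow_eq_smul _ _ hvui hM ?_ hc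
    rintro rfl
    have := hd i
    have h1 : IsUnit (φ u i ^ M) := (IsUnit.of_mul_eq_one_right _ hvui).pow M
    rw [hc, zero_smul] at h1
    exact not_isUnit_zero h1
  choose r s hr hs hru hrv using hspec
  have h0 := sum_eq_zero_of_sum_sum_mul_sum_inv_eq_zero s hM hs (by
    rw [← htr']
    refine Finset.sum_congr rfl fun i _ => ?_
    rw [hru, hrv, mul_mul_mul_comm, mul_inv_cancel₀ (hr i), one_mul])
  -- The central z acts by a scalar on each block, so T(z) is a combination of the traces of the uᵢ,
  -- all zero by `h0`.
  apply hTz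
  rw [hu]
  refine Finset.sum_eq_zero fun i _ => ?_
  obtain ⟨c, hc⟩ := hscalar z hz i
  rw [map_mul, Pi.mul_apply, hc, smul_mul_assoc, one_mul, Matrix.trace_smul, hru, h0, mul_zero,
    smul_zero]

theorem exists_natCast_eq_trace {k V : Type*} [Field k] [AddCommGroup V] [Module k V]
    [FiniteDimensional k V] {P : Module.End k V} (hP : IsIdempotentElem P) :
    LinearMap.trace k V P = (Module.finrank k (LinearMap.range P) : k) :=
  ((LinearMap.isProj_range_iff_isIdempotentElem P).2 hP).trace

/-! ### The regular character and S² = id. -/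

namespace HopfAlgebra

open LeftComoduleAlgebra

variable {k : Type*} {H : Type*} [Field k] [Ring H] [HopfAlgebra k H]

/-- The linear map `y ↦ f(y₁) y₂`. -/
noncomputable def hit (f : H →ₗ[k] k) : Module.End k H := coslice f ∘ₗ comul

variable (k H) in
/-- The square of the antipode as an endomorphism. -/
noncomputable def antipodeSq : Module.End k H := antipode k ∘ₗ antipode k

theorem sqTrace_one : sqTrace k H 1 = LinearMap.trace k H (antipodeSq k H) := by
  rw [sqTrace, traceForm_apply, LinearMap.mulLeft_one, LinearMap.id_comp]; rfl

variable [FiniteDimensional k H]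

variable (k H) in
/-- The character of the regular comodule. -/
noncomputable def regularCharacter : H :=
  ∑ i, (LeftComoduleAlgebra.self k H).coeff (Module.finBasis k H) i i

theorem apply_regularCharacter (f : H →ₗ[k] k) :
    f (regularCharacter k H) = LinearMap.trace k H (hit f) := by
  let b := Module.finBasis k H
  rw [LinearMap.trace_eq_matrix_trace k b, regularCharacter, map_sum]
  refine Finset.sum_congr rfl fun i _ => ?_
  rw [Matrix.diag_apply, LinearMap.toMatrix_apply, hit, LinearMap.comp_apply, ← self_coact,
    coact_basis]
  simp [Finsupp.single_apply]
  rfl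

/-- The trace form of the fact that the regular comodule tensored with a comodule of dimension n is
n copies of the regular one. -/
theorem regularCharacter_mul_self :
    regularCharacter k H * regularCharacter k H =
      (Module.finrank k H : k) • regularCharacter k H := by
  let b := Module.finBasis k H
  let c := (LeftComoduleAlgebra.self k H).coeff b
  rw [← sub_eq_zero, ← Module.forall_dual_apply_eq_zero_iff k]
  intro f
  rw [map_sub, sub_eq_zero, map_smul, apply_regularCharacter f]
  conv_lhs => rw [regularCharacter, Finset.mul_sum, map_sum]; rw [← regularCharacter]
  have h1 (i) : f (regularCharacter k H * c i i) =
      LinearMap.trace k H (hit (f ∘ₗ LinearMap.mulRight k (c i i))) := by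
    rw [← apply_regularCharacter]; rfl
  let R (a : H) : Module.End k H := LinearMap.mulRight k a
  let Q (i m) : Module.End k H := hit (f ∘ₗ LinearMap.mulRight k (c i m))
  have h2 (i l) : hit f * R (c i l) = ∑ m, R (c m l) * Q i m := by
    ext y
    simp only [Module.End.mul_apply, LinearMap.sum_apply, R, Q, hit, LinearMap.comp_apply,
      LinearMap.mulRight_apply, Bialgebra.comul_mul]
    rw [show comul (R := k) (c i l) = _ from comul_coeff _ b i l]
    generalize comul (R := k) y = t
    induction t with
    | zero => simp
    | add t t' h h' =>
      rw [add_mul, map_add, h, h', ← Finset.sum_add_distrib]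
      exact Finset.sum_congr rfl fun m _ => by rw [map_add, add_mul]
    | tmul u v => simp [Finset.mul_sum, c]
  have hR (a a' : H) : R a * R a' = R (a' * a) := by ext; simp [R, mul_assoc]
  have hRs {ι : Type} (s : Finset ι) (g : ι → H) : R (∑ i ∈ s, g i) = ∑ i ∈ s, R (g i) := by
    ext; simp [R, Finset.mul_sum]
  have hR1 : R 1 = 1 := by ext; simp [R]
  have hR0 : R 0 = 0 := by ext; simp [R]
  -- Inverting `h2` with the matrix S(c); cyclicity of the trace in `h4` then brings S(c_li) next to
  -- c_il.
  have h3 (i) : Q i i = ∑ l, R (antipode k (c l i)) * (hit f * R (c i l)) := by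
    simp only [h2, Finset.mul_sum]
    rw [Finset.sum_comm]
    simp only [← mul_assoc, hR, ← Finset.sum_mul, ← hRs]
    simp only [c, sum_coeff_mul_antipode_coeff]
    simp [apply_ite, hR0, hR1]
  simp only [b, c, Q] at h1 h3
  simp only [h1, h3, map_sum]
  rw [Finset.sum_comm]
  have h4 (l) : ∑ i, LinearMap.trace k H (R (antipode k (c l i)) * (hit f * R (c i l))) =
      LinearMap.trace k H (hit f) := by
    have this (i) : LinearMap.trace k H (R (antipode k (c l i)) * (hit f * R (c i l))) =
        LinearMap.trace k H (hit f * R (antipode k (c l i) * c i l)) := by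
      rw [LinearMap.trace_mul_comm, mul_assoc, hR]
    simp only [this, ← map_sum, ← Finset.mul_sum, ← hRs]
    simp [c, sum_antipode_coeff_mul_coeff, hR1]
  simp only [b, c] at h4
  simp [h4]

variable {Λ : H}

/-- S² is a coalgebra automorphism, so it conjugates y ↦ f(S²(y₁)) y₂ into y ↦ f(y₁) y₂, and the
traces agree. -/
theorem antipodeSq_regularCharacter (hΛ : IsNormalizedIntegral k Λ) :
    antipodeSq k H (regularCharacter k H) = regularCharacter k H := by
  rw [← sub_eq_zero, ← Module.forall_dual_apply_eq_zero_iff k]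
  intro f
  have hS := antipode_bijective hΛ
  let e : H ≃ₗ[k] H := LinearEquiv.ofBijective (antipodeSq k H) (hS.comp hS)
  have h1 : e.conj (hit (f ∘ₗ antipodeSq k H)) = hit f := by
    ext y
    obtain ⟨x, rfl⟩ := e.surjective y
    rw [LinearEquiv.conj_apply_apply, LinearEquiv.symm_apply_apply]
    change antipodeSq k H (coslice _ (comul x)) = coslice f (comul (antipode k (antipode k x)))
    rw [comul_antipode_antipode]
    generalize comul (R := k) x = t
    induction t with
    | zero => simp
    | add t t' h h' => simp only [map_add, h, h']
    | tmul u v => simp [antipodeSq]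
  rw [map_sub, sub_eq_zero, ← LinearMap.comp_apply, apply_regularCharacter,
    apply_regularCharacter, ← h1, LinearMap.trace_conj']

theorem sqTrace_regularCharacter (hΛ : IsNormalizedIntegral k Λ) (h : sqTrace k H 1 ≠ 0) :
    sqTrace k H (regularCharacter k H) = sqTrace k H 1 := by
  rw [apply_regularCharacter]
  have : hit (sqTrace k H) = (sqTrace k H).smulRight 1 := by
    ext x
    rw [hit, LinearMap.comp_apply, coslice_sqTrace hΛ, modularElement_eq_one hΛ h]
    rfl
  rw [this, LinearMap.trace_smulRight]

theorem antipode_antipode_of_isSemisimpleRing [IsAlgClosed k] [CharZero k] [IsSemisimpleRing H]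
    (x : H) : antipode k (antipode k x) = x := by
  obtain ⟨Λ, hΛ⟩ := exists_isNormalizedIntegral k H
  obtain ⟨M, hM, hEM⟩ := exists_pow_antipode_sq_eq_one hΛ
  have h1 : sqTrace k H 1 ≠ 0 := by
    rw [sqTrace_one]
    exact trace_ne_zero_of_twisted_form _ hM hEM (sqTrace k H) sqTrace_mul
      (fun y => eq_zero_of_sqTrace_mul_left hΛ)
      (fun x => (hΛ.mul_right x).trans (hΛ.mul_left x).symm)
      (by rw [sqTrace_integral hΛ]; exact one_ne_zero)
  let E := antipodeSq k H
  have hEE : E * E = 1 := by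
    ext y
    have := antipode_pow_four hΛ y
    rwa [modularElement_eq_one hΛ h1, one_mul, mul_one] at this
  let n := Module.finrank k H
  have : Nontrivial H := ⟨⟨1, 0, fun h => h1 (by rw [h, map_zero])⟩⟩
  have hn : (n : k) ≠ 0 := Nat.cast_ne_zero.2 Module.finrank_pos.ne'
  let χ := regularCharacter k H
  -- P and Q are commuting idempotents, Q being the projection to the fixed space of S². Since n
  -- Tr(P S²) = T(χ) = T(1) = Tr(S²), ranks yield an integer equation.
  let P : Module.End k H := LinearMap.mulLeft k ((n : k)⁻¹ • χ)
  let Q : Module.End k H := (2 : k)⁻¹ • (1 + E)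
  have hP : IsIdempotentElem P := by
    have : ((n : k)⁻¹ • χ) * ((n : k)⁻¹ • χ) = (n : k)⁻¹ • χ := by
      rw [smul_mul_smul_comm, regularCharacter_mul_self, smul_smul, mul_assoc,
        inv_mul_cancel₀ hn, mul_one]
    ext y
    simp only [P, Module.End.mul_apply, LinearMap.mulLeft_apply, ← mul_assoc, this]
  have hQ : IsIdempotentElem Q := by
    have : (1 + E) * (1 + E) = (2 : k) • (1 + E) := by
      rw [mul_add, add_mul, add_mul, hEE, two_smul]; simp; abel
    simp only [IsIdempotentElem, Q, smul_mul_smul_comm, this, smul_smul]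
    congr 1
    field_simp
  have hEP : Commute E P := by
    ext y
    have : E χ = χ := antipodeSq_regularCharacter hΛ
    simp only [E, antipodeSq, LinearMap.comp_apply] at this
    simp [E, antipodeSq, P, antipode_mul_antidistrib, this]
  have hPQ : IsIdempotentElem (P * Q) :=
    hP.mul_of_commute (((Commute.one_left P).add_left hEP).smul_left _).symm hQ
  have hE2 : E = (2 : k) • Q - 1 := by simp [Q]
  have t1 : LinearMap.trace k H (P * E) = (n : k)⁻¹ * sqTrace k H 1 := by
    rw [← sqTrace_regularCharacter hΛ h1]
    exact (sqTrace k H).map_smul _ _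
  rw [hE2, mul_sub, mul_smul_comm, map_sub, map_smul, exists_natCast_eq_trace hPQ, mul_one,
    exists_natCast_eq_trace hP, eq_inv_mul_iff_mul_eq₀ hn] at t1
  have t2 : sqTrace k H 1 = 2 * (Module.finrank k (LinearMap.range Q) : k) - n := by
    rw [sqTrace_one, show antipodeSq k H = E from rfl, hE2, map_sub, map_smul,
      exists_natCast_eq_trace hQ, LinearMap.trace_one, smul_eq_mul]
  set a := Module.finrank k (LinearMap.range (P * Q))
  set b := Module.finrank k (LinearMap.range P)
  set q := Module.finrank k (LinearMap.range Q) with hq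
  have hqn : q ≤ n := Submodule.finrank_le _
  have hn0 : 0 < n := Module.finrank_pos
  have hint : (n : ℤ) * (2 * a - b) = 2 * q - n := by
    have := t1.trans t2
    rw [smul_eq_mul] at this
    exact_mod_cast this
  have hm : (2 * a - b : ℤ) ≠ 0 := by
    intro h
    apply h1
    rw [t2]
    rw [h, mul_zero] at hint
    exact_mod_cast hint.symm
  have hq0 : q ≠ 0 := by
    intro h0
    rw [hq, Submodule.finrank_eq_zero, LinearMap.range_eq_bot] at h0
    have h2 : Q 1 = 1 := by
      simp only [Q, E, antipodeSq, LinearMap.smul_apply, LinearMap.add_apply, Module.End.one_apply,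
        LinearMap.comp_apply, antipode_one, ← two_smul k (1 : H), smul_smul]
      norm_num
    rw [h0] at h2
    exact one_ne_zero h2.symm
  -- The equation is n m = 2q - n with m a nonzero integer and 0 < q ≤ n: m < 0 would force q ≤ 0,
  -- and m > 0 forces q = n.
  have hqn' : q = n := by
    rcases lt_or_gt_of_ne hm with h | h
    · nlinarith [show (0 : ℤ) < q by positivity]
    · nlinarith
  have hQ1 : Q = 1 := by
    have hr := Submodule.eq_top_of_finrank_eq (hq.symm.trans hqn')
    ext y
    obtain ⟨z, rfl⟩ := LinearMap.range_eq_top.1 hr y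
    rw [← Module.End.mul_apply, hQ.eq]; rfl
  have hE1 : E = 1 := by rw [hE2, hQ1, two_smul, add_sub_cancel_right]
  exact LinearMap.congr_fun hE1 x

end HopfAlgebra

/-! ### Separability idempotents and regular traces. -/

open LeftComoduleAlgebra

theorem eq_zero_of_coslice_coord {k V W ι : Type*} [Field k] [AddCommGroup V] [Module k V]
    [AddCommGroup W] [Module k W] [Fintype ι] (b : Module.Basis ι k V) {z : V ⊗[k] W}
    (h : ∀ i, coslice (b.coord i) z = 0) : z = 0 := by
  have key : ∀ z : V ⊗[k] W, ∑ i, b i ⊗ₜ[k] coslice (b.coord i) z = z := by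
    intro z
    induction z with
    | zero => simp
    | add t t' h h' => simp only [map_add, TensorProduct.tmul_add, Finset.sum_add_distrib, h, h']
    | tmul v w =>
      conv_rhs => rw [← b.sum_repr v, TensorProduct.sum_tmul]
      simp [TensorProduct.smul_tmul]
  rw [← key z]
  simp [h]

namespace IsSymmSepIdempotent

variable {k A : Type*} [Field k] [Ring A] [Algebra k A] {π : A ⊗[k] A}

theorem finiteDimensional (hπ : IsSymmSepIdempotent k π) : FiniteDimensional k A :=
  .of_separability π hπ.invariance hπ.normalization

theorem rTensor_mulRight (hπ : IsSymmSepIdempotent k π) (y : A) :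
    LinearMap.rTensor A (LinearMap.mulRight k y) π =
      LinearMap.lTensor A (LinearMap.mulLeft k y) π := by
  have h (f : A →ₗ[k] A) (z : A ⊗[k] A) : TensorProduct.comm k A A (LinearMap.rTensor A f z) =
      LinearMap.lTensor A f (TensorProduct.comm k A A z) := by
    induction z with
    | zero => simp
    | add t t' h h' => simp only [map_add, h, h']
    | tmul u v => simp
  have h' (f : A →ₗ[k] A) (z : A ⊗[k] A) : TensorProduct.comm k A A (LinearMap.lTensor A f z) =
      LinearMap.rTensor A f (TensorProduct.comm k A A z) := by
    induction z with
    | zero => simp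
    | add t t' h h' => simp only [map_add, h, h']
    | tmul u v => simp
  have := congrArg (TensorProduct.comm k A A) (hπ.invariance y)
  rw [h, h', hπ.symmetry] at this
  exact this.symm

/-- A symmetric separability idempotent is dual to the trace form of the regular
representation. -/
theorem coslice_traceForm (hπ : IsSymmSepIdempotent k π) (x : A) :
    coslice (traceForm A LinearMap.id ∘ₗ LinearMap.mulLeft k x) π = x := by
  have := hπ.finiteDimensional
  let b := Module.finBasis k A
  -- Expanding Tr over a basis gives ∑ bᵢ*(x π¹ bᵢ) π²; moving bᵢ to the second leg gives ∑ bᵢ*(x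
  -- π¹) bᵢ π² = x π¹ π².
  have h1 : ∀ z : A ⊗[k] A, coslice (traceForm A LinearMap.id ∘ₗ LinearMap.mulLeft k x) z =
      ∑ i, coslice (b.coord i ∘ₗ LinearMap.mulLeft k x)
        (LinearMap.rTensor A (LinearMap.mulRight k (b i)) z) := by
    intro z
    induction z with
    | zero => simp
    | add t t' h h' => simp only [map_add, h, h', Finset.sum_add_distrib]
    | tmul u v => simp [traceForm_eq_sum b, Finset.sum_smul, mul_assoc]
  have h2 : ∀ z : A ⊗[k] A, ∑ i, coslice (b.coord i ∘ₗ LinearMap.mulLeft k x)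
      (LinearMap.lTensor A (LinearMap.mulLeft k (b i)) z) = x * LinearMap.mul' k A z := by
    intro z
    induction z with
    | zero => simp
    | add t t' h h' => simp only [map_add, h, h', Finset.sum_add_distrib, mul_add]
    | tmul u v =>
      have := congrArg (· * v) (b.sum_repr (x * u))
      simpa [-Module.Basis.sum_repr, Finset.sum_mul, mul_assoc] using this
  rw [h1]
  simp only [hπ.rTensor_mulRight]
  rw [h2, hπ.normalization, mul_one]

theorem exists_traceForm_eq (hπ : IsSymmSepIdempotent k π) (φ : A →ₗ[k] k) :
    ∃ a, traceForm A LinearMap.id ∘ₗ LinearMap.mulLeft k a = φ := by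
  have := hπ.finiteDimensional
  let Φ : A →ₗ[k] (A →ₗ[k] k) := (LinearMap.mul k A).compr₂ (traceForm A LinearMap.id)
  have hΦ (a) : Φ a = traceForm A LinearMap.id ∘ₗ LinearMap.mulLeft k a := rfl
  have hinj : Function.Injective Φ := by
    rw [← LinearMap.ker_eq_bot, LinearMap.ker_eq_bot']
    intro a ha
    rw [← hπ.coslice_traceForm a, ← hΦ, ha]
    simp [coslice]
  exact (LinearMap.injective_iff_surjective_of_finrank_eq_finrank
      (Subspace.dual_finrank_eq (K := k) (V := A)).symm).1 hinj φ

end IsSymmSepIdempotent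

theorem traceForm_id_mul_comm {k A : Type*} [Field k] [Ring A] [Algebra k A] (x y : A) :
    traceForm A (LinearMap.id : A →ₗ[k] A) (x * y) = traceForm A LinearMap.id (y * x) := by
  simp only [traceForm_apply, LinearMap.comp_id, LinearMap.mulLeft_mul]
  exact LinearMap.trace_mul_comm k _ _

theorem LeftModuleAlgebra.traceForm_act_mul {k H A : Type*} [Field k] [Ring H] [HopfAlgebra k H]
    [FiniteDimensional k H] [Ring A] [Algebra k A] (α : LeftModuleAlgebra k H A)
    (hS : ∀ h : H, antipode k (antipode k h) = h) (h : H) (a b : A) :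
    traceForm A (LinearMap.id : A →ₗ[k] A) (α.act h a * b) =
      traceForm A LinearMap.id (a * α.act (antipode k h) b) := by
  let β := Module.finBasis k H
  let c := (LeftComoduleAlgebra.self k H).coeff β
  have hc (i j) : comul (R := k) (c i j) = ∑ l, c i l ⊗ₜ[k] c l j := comul_coeff _ β i j
  -- For h = c_ij this says h₁.(a (S(h₂).b)) = (h.a) b. It reduces the claim to the invariance
  -- Tr(h.a) = ε(h) Tr(a) in `h2`, where cyclicity produces S(h₂) h₁; that equals ε(h) because S² =
  -- id.
  have h1 (i j) (a b : A) : ∑ l, α.act (c i l) (a * α.act (antipode k (c l j)) b) =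
      α.act (c i j) a * b := by
    simp only [α.act_mul, hc, map_sum, TensorProduct.map_tmul, LinearMap.mul'_apply,
      LinearMap.flip_apply, AlgHom.toLinearMap_apply, ← Module.End.mul_apply, ← map_mul]
    rw [Finset.sum_comm]
    simp only [← Finset.mul_sum, ← LinearMap.sum_apply, ← map_sum]
    simp only [c, sum_coeff_mul_antipode_coeff]
    simp [apply_ite, ite_apply]
  have h2 (i j) (a : A) : traceForm A (LinearMap.id : A →ₗ[k] A) (α.act (c i j) a) =
      if i = j then traceForm A LinearMap.id a else 0 := by
    have e : LinearMap.mulLeft k (α.act (c i j) a) =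
        ∑ l, α.act (c i l) * (LinearMap.mulLeft k a * α.act (antipode k (c l j))) := by
      ext b
      simp [← h1]
    have e' (l) : LinearMap.trace k A
        (α.act (c i l) * (LinearMap.mulLeft k a * α.act (antipode k (c l j)))) =
        LinearMap.trace k A
          (LinearMap.mulLeft k a * α.act (antipode k (c l j) * c i l)) := by
      rw [LinearMap.trace_mul_comm, map_mul α.act, mul_assoc]
    have e3 : ∑ l, antipode k (c l j) * c i l = if i = j then 1 else 0 := by
      have h4 := congrArg (antipode k)
        ((LeftComoduleAlgebra.self k H).sum_antipode_coeff_mul_coeff β i j)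
      simpa [antipode_mul_antidistrib, hS, apply_ite, antipode_one] using h4
    simp only [traceForm_apply, LinearMap.comp_id]
    rw [e, map_sum]
    simp only [e', ← map_sum, ← Finset.mul_sum, e3]
    split_ifs <;> simp
  let t : A →ₗ[k] k := traceForm A LinearMap.id
  suffices t ∘ₗ LinearMap.mulRight k b ∘ₗ α.act.toLinearMap.flip a =
      t ∘ₗ LinearMap.mulLeft k a ∘ₗ α.act.toLinearMap.flip b ∘ₗ antipode k from
    LinearMap.congr_fun this h
  refine linearMap_ext_coeff β fun i j => ?_
  change t (α.act (c i j) a * b) = t (a * α.act (antipode k (c i j)) b)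
  simp only [← h1, map_sum, t, h2]
  simp

/-! ### Comparing the two products in the enveloping algebra. -/

namespace CrossedProduct

variable {k H A K : Type*} [Field k]
  [Ring H] [HopfAlgebra k H] [Ring A] [Algebra k A] [Ring K] [Algebra k K]
  (α : LeftModuleAlgebra k H A) (δ : LeftComoduleAlgebra k H K)

theorem inl_mul_inr (a : A) (x : K) : inl α δ a * inr α δ x = tmul α δ a x := by
  have := tmul_mul_tmul α δ (Finset.univ : Finset Unit) (fun _ => (1 : H)) (fun _ => (1 : K))
    a 1 1 x (by simp [Algebra.TensorProduct.one_def])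
  refine Eq.trans this ?_
  simp

theorem inr_mul_inl (a : A) (x : K) : inr α δ x * inl α δ a = actL α a (δ.coact x) := by
  change mulAux α δ (1 ⊗ₜ[k] x) (a ⊗ₜ[k] 1) = _
  rw [mulAux_tmul]
  have h1 : LinearMap.mulLeft k (1 : A) = LinearMap.id := by ext; simp
  have h2 : LinearMap.mulRight k (1 : K) = LinearMap.id := by ext; simp
  rw [h1, h2, TensorProduct.map_id, LinearMap.id_apply]

/-- The linear form `b ⊗ y ↦ Tr(a b) Tr(x y)` on the crossed product. -/
noncomputable def traceFunctional (a : A) (x : K) : CrossedProduct α δ →ₗ[k] k :=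
  LinearMap.mul' k k ∘ₗ TensorProduct.map (traceForm A LinearMap.id ∘ₗ LinearMap.mulLeft k a)
    (traceForm K LinearMap.id ∘ₗ LinearMap.mulLeft k x)

theorem traceFunctional_tmul (a b : A) (x y : K) : traceFunctional α δ a x (tmul α δ b y) =
    traceForm A (LinearMap.id : A →ₗ[k] A) (a * b) *
      traceForm K (LinearMap.id : K →ₗ[k] K) (x * y) := rfl

variable {α δ}

theorem eq_of_coslice_traceFunctional {p : K ⊗[k] K} (hp : IsSymmSepIdempotent k p)
    {π : A ⊗[k] A} (hπ : IsSymmSepIdempotent k π) {W : Type*} [AddCommGroup W] [Module k W]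
    {z z' : CrossedProduct α δ ⊗[k] W}
    (h : ∀ a x, coslice (traceFunctional α δ a x) z = coslice (traceFunctional α δ a x) z') :
    z = z' := by
  have := hp.finiteDimensional
  have := hπ.finiteDimensional
  let b : Module.Basis _ k (CrossedProduct α δ) :=
    (Module.finBasis k A).tensorProduct (Module.finBasis k K)
  rw [← sub_eq_zero]
  refine eq_zero_of_coslice_coord b fun ⟨i, j⟩ => ?_
  obtain ⟨a, ha⟩ := hπ.exists_traceForm_eq ((Module.finBasis k A).coord i)
  obtain ⟨x, hx⟩ := hp.exists_traceForm_eq ((Module.finBasis k K).coord j)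
  have hb : b.coord (i, j) = traceFunctional α δ a x := by
    rw [traceFunctional, ha, hx]
    refine TensorProduct.ext' fun u v => ?_
    exact (Module.Basis.tensorProduct_repr_tmul_apply (Module.finBasis k A) (Module.finBasis k K)
      u v i j).trans (mul_comm _ _)
  rw [hb, map_sub, h, sub_self]

theorem coslice_inl_mul_inr {p : K ⊗[k] K} (hp : IsSymmSepIdempotent k p)
    {π : A ⊗[k] A} (hπ : IsSymmSepIdempotent k π) (a : A) (x : K) :
    coslice (traceFunctional α δ a x)
      (toEnveloping (inl α δ) π * toEnveloping (inr α δ) p) =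
        MulOpposite.op (inr α δ x * inl α δ a) := by
  have key : ∀ (s : A ⊗[k] A) (r : K ⊗[k] K), coslice (traceFunctional α δ a x)
      (toEnveloping (inl α δ) s * toEnveloping (inr α δ) r) = MulOpposite.op
        (inr α δ (coslice (traceForm K LinearMap.id ∘ₗ LinearMap.mulLeft k x) r) *
          inl α δ (coslice (traceForm A LinearMap.id ∘ₗ LinearMap.mulLeft k a) s)) := by
    intro s r
    induction s with
    | zero => simp
    | add s s' h h' => simp only [map_add, add_mul, mul_add, h, h', MulOpposite.op_add]
    | tmul u v =>
    induction r with
    | zero => simp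
    | add r r' h h' => simp only [map_add, add_mul, mul_add, h, h', MulOpposite.op_add]
    | tmul y w =>
      simp only [toEnveloping, TensorProduct.map_tmul, Algebra.TensorProduct.tmul_mul_tmul,
        coslice_tmul, inl_mul_inr, traceFunctional_tmul, LinearMap.comp_apply,
        LinearMap.mulLeft_apply, map_smul, LinearEquiv.coe_coe, MulOpposite.coe_opLinearEquiv,
        ← MulOpposite.op_mul, ← MulOpposite.op_smul, smul_mul_smul_comm, mul_comm]
  rw [key, hp.coslice_traceForm, hπ.coslice_traceForm]

theorem coslice_inr_mul_inl [FiniteDimensional k H]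
    (hS : ∀ h : H, antipode k (antipode k h) = h) {p : K ⊗[k] K} (hp : IsSymmSepIdempotent k p)
    {π : A ⊗[k] A} (hπ : IsSymmSepIdempotent k π) (a : A) (x : K) :
    coslice (traceFunctional α δ a x)
      (toEnveloping (inr α δ) p * toEnveloping (inl α δ) π) =
        MulOpposite.op (inr α δ x * inl α δ a) := by
  have := hp.finiteDimensional
  let t : K →ₗ[k] k := traceForm K LinearMap.id
  have ht : δ.IsCoinvariant t := by
    refine δ.isCoinvariant_traceForm _ fun x => ?_
    have : antipode k ∘ₗ antipode k = (LinearMap.id : H →ₗ[k] H) := LinearMap.ext hS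
    simp [this]
  -- Here σ(y) = S(y₍₋₁₎) Tr(x y₍₀₎) is what acts on a after the action is moved across Tr on `A`.
  -- By `hσ` it equals x₍₋₁₎ Tr(x₍₀₎ y), where the two antipodes cancel.
  let σ : K →ₗ[k] H := antipode k ∘ₗ slice k H (t ∘ₗ LinearMap.mulLeft k x) ∘ₗ δ.coact.toLinearMap
  let G : K ⊗[k] K →ₗ[k] A ⊗[k] K := TensorProduct.map (α.act.toLinearMap.flip a ∘ₗ σ) LinearMap.id
  have hσ (y : K) : σ y = slice k H (t ∘ₗ LinearMap.mulRight k y) (δ.coact x) := by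
    simp only [σ, LinearMap.comp_apply, AlgHom.toLinearMap_apply, ht.slice_mulLeft_coact, hS]
  have hΦ (u : A) (y : K) : traceFunctional α δ a x (inr α δ y * inl α δ u) =
      traceForm A (LinearMap.id : A →ₗ[k] A) (α.act (σ y) a * u) := by
    rw [inr_mul_inl]
    simp only [σ, LinearMap.comp_apply, AlgHom.toLinearMap_apply]
    generalize δ.coact y = z
    induction z with
    | zero =>
      simp only [map_zero, LinearMap.zero_apply, zero_mul]
      exact map_zero (traceFunctional α δ a x)
    | add z z' h h' =>
      simp only [map_add, LinearMap.add_apply, add_mul]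
      rw [← h, ← h']
      exact map_add (traceFunctional α δ a x) _ _
    | tmul h y =>
      have h1 : actL α u (h ⊗ₜ[k] y) = tmul α δ (α.act h u) y := rfl
      rw [h1, traceFunctional_tmul, traceForm_id_mul_comm a, α.traceForm_act_mul hS,
        traceForm_id_mul_comm u, slice_tmul, map_smul, map_smul, LinearMap.smul_apply,
        smul_mul_assoc, map_smul, smul_eq_mul, mul_comm]
      rfl
  have h1 : ∀ r, coslice (traceFunctional α δ a x)
      (toEnveloping (inr α δ) r * toEnveloping (inl α δ) π) = MulOpposite.op (G r) := by
    intro r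
    induction r with
    | zero => simp only [map_zero, zero_mul]; rfl
    | add r r' h h' =>
      rw [map_add, add_mul, map_add, h, h', map_add]; rfl
    | tmul y w =>
      have h2 : ∀ s, coslice (traceFunctional α δ a x)
          (toEnveloping (inr α δ) (y ⊗ₜ[k] w) * toEnveloping (inl α δ) s) = MulOpposite.op
          (inl α δ (coslice (traceForm A LinearMap.id ∘ₗ LinearMap.mulLeft k (α.act (σ y) a)) s)
            * inr α δ w) := by
        intro s
        induction s with
        | zero => simp
        | add s s' h h' => simp only [map_add, add_mul, mul_add, h, h', MulOpposite.op_add]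
        | tmul u v =>
          simp only [toEnveloping, TensorProduct.map_tmul, Algebra.TensorProduct.tmul_mul_tmul,
            coslice_tmul, hΦ, LinearMap.comp_apply,
            LinearMap.mulLeft_apply, map_smul, LinearEquiv.coe_coe, MulOpposite.coe_opLinearEquiv,
            ← MulOpposite.op_mul, ← MulOpposite.op_smul, smul_mul_assoc]
      rw [h2, hπ.coslice_traceForm, inl_mul_inr]
      rfl
  rw [h1, inr_mul_inl]
  congr 1
  obtain ⟨s, hs⟩ := TensorProduct.exists_finset (δ.coact x)
  -- In the second form of σ, the remaining contraction Tr(x₍₀₎ p¹) p² is x₍₀₎ by duality.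
  have h2 : ∀ r, G r = ∑ i ∈ s, α.act i.1 a ⊗ₜ[k] coslice (t ∘ₗ LinearMap.mulLeft k i.2) r := by
    intro r
    induction r with
    | zero => simp
    | add r r' h h' => simp only [map_add, TensorProduct.tmul_add, Finset.sum_add_distrib, h, h']
    | tmul y w =>
      simp only [G, TensorProduct.map_tmul, LinearMap.comp_apply, hσ, hs, map_sum, slice_tmul,
        map_smul, TensorProduct.sum_tmul, LinearMap.id_apply, coslice_tmul,
        LinearMap.mulRight_apply, LinearMap.mulLeft_apply, TensorProduct.tmul_smul]
      rfl
  simp only [h2, t, hp.coslice_traceForm, hs, map_sum]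
  rfl

end CrossedProduct

theorem mainTheorem4
    {k : Type u} {H : Type v} {K : Type w} {A : Type x}
    [Field k] [IsAlgClosed k] [CharZero k]
    [Ring H] [HopfAlgebra k H] [IsSemisimpleRing H]
    [Ring K] [Algebra k K] [IsSemisimpleRing K]
    [Ring A] [Algebra k A] [IsSemisimpleRing A]
    (δ : LeftComoduleAlgebra k H K) (α : LeftModuleAlgebra k H A)
    (p : K ⊗[k] K) (hp : IsSymmSepIdempotent k p)
    (π : A ⊗[k] A) (hπ : IsSymmSepIdempotent k π) :
    Commute (toEnveloping (CrossedProduct.inr α δ) p)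
      (toEnveloping (CrossedProduct.inl α δ) π) := by
  have := finiteDimensional_of_isSemisimpleRing k H
  have hS : ∀ h : H, antipode k (antipode k h) = h := antipode_antipode_of_isSemisimpleRing
  exact CrossedProduct.eq_of_coslice_traceFunctional hp hπ fun a x => by
    rw [CrossedProduct.coslice_inr_mul_inl hS hp hπ, CrossedProduct.coslice_inl_mul_inr hp hπ]
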